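/- Let $d\in\{1,2,3\}$. Let $\sigma:\mathbf R\to\mathbf R$ be locally integrable on $[0,\infty)$, and let $\zeta_1,\zeta_2$ be the solutions of $\zeta_j''+\sigma\zeta_j=0$ on $[0,\infty)$ with $\zeta_1(0)=1,\ \zeta_1'(0)=0$ and $\zeta_2(0)=0,\ \zeta_2'(0)=1$. Assume that for some $r_0>0$, $c>0$, some $\lambda\in(0,1/2)$ and some constants $\sigma_0,c_1^{(k)},c_2^{(k)}\in\mathbf R\setminus\{0\}$, $c_3\in\mathbf R$: $\sigma\in C^1([r_0,\infty))$ with $\lim_{t\to\infty}t^3\sigma'(t)=\sigma_0$; $|\zeta_2(t)|\ge c$ and $\zeta_1(t),\zeta_2(t)\ge 0$ for all $t>r_0$; and for $k\in\{0,1,2\}$ $$\lim_{t\to\infty}\frac{|\zeta_1^{(k)}(t)|}{t^{\lambda-k}}=c_1^{(k)},\qquad \lim_{t\to\infty}\frac{|\zeta_2^{(k)}(t)|}{t^{1-\lambda-k}}=c_2^{(k)},\qquad \lim_{t\to\infty}\frac{|\zeta_2(t)-c_2^{(0)}t^{1-\lambda}|}{t^{\lambda}}=c_3 .$$ Assume moreover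 $\lambda<4-\sqrt{15}$ if $d=1$, $\lambda<\frac15$ if $d=2$, $\lambda<\frac{13-2\sqrt{37}}{21}$ if $d=3$. Put $\rho=1-2\lambda$ and, for $n\in\mathbf Z\setminus\{0,1\}$, $$C_n(t)=1+(n-1)\zeta_1(t)\zeta_2'(t),\qquad A_n(t)=\frac{(n-1)\zeta_2(t)\zeta_2'(t)}{2C_n(t)},\qquad B_n(t)=\frac{\zeta_1(t)C_n(t)}{2\zeta_2(t)} .$$ Let $(\mathcal D(\tau)\varphi)(x)=(i\tau)^{-d/2}\varphi(x/\tau)$ for $\tau\ne0$, let $\mathcal A_n(t)$ be multiplication by $(1+itA_n'(t)|x|^2)^{-1}$, and for $\psi_0\in C_0^\infty(\mathbf R^d)$ with $0\le\psi_0\le1$, $\psi_0=1$ on $\{|y|\le1\}$ and $\psi_0=0$ on $\{|y|>2\}$ let $\mathcal K=\psi_0\big(-i\nabla/(|n|t^{\rho/2})\big)$, and $$\mathcal G_n(t)=\mathcal A_n(t)\,e^{iB_n(t)\Delta}\,\mathcal D(C_n(t))\,\mathcal K .$$ Then there is $T_0\ge1$, $T_0>r_0$, depending only on $d$, $\lambda$,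 $r_0$, $\sigma$, such that $\zeta_2(t)\neq0$, $C_n(t)\ne0$ and $A_n$ is differentiable at $t$ for all $t\ge T_0$ and $n\ne0,1$, and such that the following holds for every $\psi_0$ as above and every $\delta$ with $$\frac{1+4\lambda-\lambda^2}{2(1-2\lambda)}<\delta<1\ \ (d=1),\qquad \frac{d(\lambda+1)}{2(1-2\lambda)}<\delta<\min\Big(2,\,1+\frac{2}{d(1-\lambda)}\Big)\ \ (d=2,3).$$ Let $\kappa=\frac12(\delta-\frac d2)$. (i) There is $C>0$ such that for all $t\ge T_0$, all $n\in\mathbf Z\setminus\{0,1\}$ and all $\varphi\in L^2(\mathbf R^d)$, $$\|\mathcal G_n(t)\varphi\|_{2}\le C\,t^{-\frac{\delta}{2}\rho}\,|n|^{-\delta+\kappa}\big(\|\varphi\|_{\dot H^\delta}+|\psi_0(0)|\,\||\xi|^{-\delta}\varphi\|_{2}\big).$$ (ii) For every $r\in(2,\infty]$, with $\nu=d\big(\frac12-\frac1r\big)$, there is $C>0$ such that for all $t\ge T_0$, all $n\in\mathbf Z\setminus\{0,1\}$ and all $\varphi\in L^2(\mathbf R^d)$, $$\|e^{-iB_n(t)\Delta}\mathcal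 G_n(t)\varphi\|_{r}\le C\,t^{\frac{\nu-\delta}{2}\rho}\,|n|^{-\delta+\kappa}\big(\|\varphi\|_{\dot H^\delta}+|\psi_0(0)|\,\||\xi|^{-\delta}\varphi\|_{2}\big).$$ Here $\|\varphi\|_{\dot H^\delta}=\||\nabla|^\delta\varphi\|_2$, and the right-hand sides are allowed to be $+\infty$. -/

import Mathlib

open MeasureTheory Filter Topology Set
open scoped ENNReal ContDiff FourierTransform

noncomputable section

namespace TDHarmonic

/-! ### The time-decaying coefficient and the fundamental solutions -/

/-- `ζ` solves `ζ'' + σ ζ = 0` on `[0, ∞)` with `ζ 0 = a`, `ζ' 0 = b`, for a coefficient `σ` that is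
only locally integrable: `ζ` is differentiable and its derivative `v` is the primitive
`v t = b - ∫₀ᵗ σ ζ`. -/
def SolvesOscillator (σ ζ : ℝ → ℝ) (a b : ℝ) : Prop :=
  ζ 0 = a ∧ ∃ v : ℝ → ℝ, ∀ t, 0 ≤ t →
    HasDerivWithinAt ζ (v t) (Ici 0) t ∧ v t = b - ∫ s in (0 : ℝ)..t, σ s * ζ s

/-- The time-decay condition on the coefficient `σ`, expressed through the fundamental solutions
`ζ₁`, `ζ₂` of `ζ'' + σ ζ = 0`. On `(r₀, ∞)` the coefficient is continuous, so that `ζ₁`, `ζ₂` are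
twice continuously differentiable there and the iterated derivatives below are genuine. -/
structure TimeDecay (σ ζ₁ ζ₂ : ℝ → ℝ) (r₀ lam : ℝ) : Prop where
  locallyIntegrable : LocallyIntegrableOn σ (Ici 0)
  solves₁ : SolvesOscillator σ ζ₁ 1 0
  solves₂ : SolvesOscillator σ ζ₂ 0 1
  r₀_pos : 0 < r₀
  lam_nonneg : 0 ≤ lam
  lam_lt : lam < 1 / 2
  contDiffOn : ContDiffOn ℝ 1 σ (Ici r₀)
  deriv_limit : ∃ σ₀ : ℝ, σ₀ ≠ 0 ∧ Tendsto (fun t => t ^ 3 * deriv σ t) atTop (𝓝 σ₀)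
  lower_bound : ∃ c : ℝ, 0 < c ∧ ∀ t, r₀ < t → c ≤ |ζ₂ t|
  asymptotics : ∃ (c₁ c₂ : ℕ → ℝ) (c₃ : ℝ),
    (∀ k ≤ 2, c₁ k ≠ 0 ∧ c₂ k ≠ 0 ∧
      Tendsto (fun t => |iteratedDeriv k ζ₁ t| / t ^ (lam - k)) atTop (𝓝 (c₁ k)) ∧
      Tendsto (fun t => |iteratedDeriv k ζ₂ t| / t ^ (1 - lam - k)) atTop (𝓝 (c₂ k))) ∧
    Tendsto (fun t => |ζ₂ t - c₂ 0 * t ^ (1 - lam)| / t ^ lam) atTop (𝓝 c₃)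

/-- The upper bound for `λ` in dimensions `1`, `2`, `3`. -/
def lamMax (d : ℕ) : ℝ :=
  if d = 1 then 4 - √15 else if d = 2 then 1 / 5 else (13 - 2 * √37) / 21

/-- The range of the regularity exponent `δ` in dimensions `1`, `2`, `3`;
`1 + 2 / (d (1 - λ))` is the degree of the nonlinearity. -/
def DeltaRange (d : ℕ) (lam δ : ℝ) : Prop :=
  if d = 1 then
    (1 + 4 * lam - lam ^ 2) / (2 * (1 - 2 * lam)) < δ ∧ δ < 1
  else
    d * (lam + 1) / (2 * (1 - 2 * lam)) < δ ∧ δ < min 2 (1 + 2 / (d * (1 - lam)))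

/-- `A_n(t)`. -/
def coeffA (ζ₁ ζ₂ : ℝ → ℝ) (n : ℤ) (t : ℝ) : ℝ :=
  (n - 1) * ζ₂ t * deriv ζ₂ t / (2 * (1 + (n - 1) * ζ₁ t * deriv ζ₂ t))

/-- `B_n(t)`. -/
def coeffB (ζ₁ ζ₂ : ℝ → ℝ) (n : ℤ) (t : ℝ) : ℝ :=
  ζ₁ t * (1 + (n - 1) * ζ₁ t * deriv ζ₂ t) / (2 * ζ₂ t)

/-- `C_n(t)`. -/
def coeffC (ζ₁ ζ₂ : ℝ → ℝ) (n : ℤ) (t : ℝ) : ℝ :=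
  1 + (n - 1) * ζ₁ t * deriv ζ₂ t

/-! ### Operators on `L²(ℝᵈ)` -/

/-- The space `L²(ℝᵈ; ℂ)`. -/
abbrev L2 (d : ℕ) : Type := Lp ℂ 2 (volume : Measure (EuclideanSpace ℝ (Fin d)))

variable {d : ℕ}

/-- A bounded measurable function. -/
def BddSymbol (m : EuclideanSpace ℝ (Fin d) → ℂ) : Prop :=
  Measurable m ∧ ∃ M : ℝ, ∀ x, ‖m x‖ ≤ M

theorem BddSymbol.memLp_mul {m : EuclideanSpace ℝ (Fin d) → ℂ} (hm : BddSymbol m) (φ : L2 d) :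
    MemLp (fun x => m x * φ x) 2 volume := by
  obtain ⟨hmeas, M, hM⟩ := hm
  exact (Lp.memLp φ).mul' (memLp_top_of_bound hmeas.aestronglyMeasurable M (ae_of_all _ hM))

theorem BddSymbol.comp_smul {m : EuclideanSpace ℝ (Fin d) → ℂ} (hm : BddSymbol m) (c : ℝ) :
    BddSymbol (fun x => m (c • x)) :=
  ⟨hm.1.comp (measurable_const_smul c), hm.2.imp fun _ h _ => h _⟩

/-- Multiplication by a bounded measurable function. -/
def mulOp (m : EuclideanSpace ℝ (Fin d) → ℂ) (hm : BddSymbol m) (φ : L2 d) : L2 d :=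
  (hm.memLp_mul φ).toLp _

/-- The Fourier multiplier `m(-i∇)` with a bounded symbol `m`. The Fourier transform used here has
the kernel `exp (-2πi x·ξ)`, so that `-i∇` corresponds to multiplication by `2πξ`. -/
def fourierMul (m : EuclideanSpace ℝ (Fin d) → ℂ) (hm : BddSymbol m) (φ : L2 d) : L2 d :=
  𝓕⁻ (mulOp (fun ξ => m ((2 * Real.pi) • ξ)) (hm.comp_smul _) (𝓕 φ))

theorem bddSymbol_schrodinger (b : ℝ) :
    BddSymbol (fun ξ : EuclideanSpace ℝ (Fin d) =>
      Complex.exp (((-(b * ‖ξ‖ ^ 2) : ℝ) : ℂ) * Complex.I)) :=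
  ⟨by fun_prop, 1, fun ξ => (Complex.norm_exp_ofReal_mul_I _).le⟩

/-- The unitary operator `e^{ibΔ}`, with symbol `e^{-ib|ξ|²}`. -/
def expLap (b : ℝ) (φ : L2 d) : L2 d := fourierMul _ (bddSymbol_schrodinger b) φ

theorem bddSymbol_reg (c : ℝ) :
    BddSymbol (fun x : EuclideanSpace ℝ (Fin d) =>
      (1 + Complex.I * ((c * ‖x‖ ^ 2 : ℝ) : ℂ))⁻¹) := by
  refine ⟨by fun_prop, 1, fun x => ?_⟩
  rw [norm_inv]
  apply inv_le_one_of_one_le₀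
  have h := Complex.abs_re_le_norm (1 + Complex.I * ((c * ‖x‖ ^ 2 : ℝ) : ℂ))
  rwa [Complex.add_re, Complex.I_mul_re, Complex.ofReal_im, Complex.one_re, neg_zero, add_zero,
    abs_one] at h

/-- Multiplication by `(1 + i t a |x|²)⁻¹`. -/
def regOp (t a : ℝ) (φ : L2 d) : L2 d := mulOp _ (bddSymbol_reg (t * a)) φ

theorem memLp_dilation {τ : ℝ} (hτ : τ ≠ 0) (φ : L2 d) :
    MemLp (fun x => (Complex.I * (τ : ℂ)) ^ (-((d : ℂ) / 2)) * φ (τ⁻¹ • x)) 2 volume := by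
  refine MemLp.const_mul ?_ _
  have hmap := Measure.map_addHaar_smul
    (volume : Measure (EuclideanSpace ℝ (Fin d))) (inv_ne_zero hτ)
  refine MemLp.comp_of_map (f := fun x => τ⁻¹ • x) ?_
    (measurable_const_smul τ⁻¹).aemeasurable
  rw [hmap]
  exact (Lp.memLp φ).smul_measure ENNReal.ofReal_ne_top

/-- The dilation `(𝒟(τ) φ)(x) = (iτ)^{-d/2} φ(x/τ)`, for `τ ≠ 0`. -/
def dilation (τ : ℝ) (φ : L2 d) : L2 d :=
  open Classical in if hτ : τ ≠ 0 then (memLp_dilation hτ φ).toLp _ else 0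

/-- A smooth cut-off function: `ψ = 1` on `|y| ≤ 1`, `ψ = 0` on `|y| > 2`, `0 ≤ ψ ≤ 1`. -/
structure Cutoff (d : ℕ) where
  toFun : EuclideanSpace ℝ (Fin d) → ℝ
  smooth : ContDiff ℝ ∞ toFun
  eq_one : ∀ y, ‖y‖ ≤ 1 → toFun y = 1
  eq_zero : ∀ y, 2 < ‖y‖ → toFun y = 0
  nonneg : ∀ y, 0 ≤ toFun y
  le_one : ∀ y, toFun y ≤ 1

theorem bddSymbol_cutoff (ψ : Cutoff d) (c : ℝ) :
    BddSymbol (fun ξ : EuclideanSpace ℝ (Fin d) => ((ψ.toFun (c • ξ) : ℝ) : ℂ)) := by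
  have hc := ψ.smooth.continuous
  refine ⟨by fun_prop, 1, fun ξ => ?_⟩
  rw [Complex.norm_real, Real.norm_of_nonneg (ψ.nonneg _)]
  exact ψ.le_one _

/-- The regularizing operator `𝒦 = ψ(-i∇ / (|n| t^{ρ/2}))` with `ρ = 1 - 2λ`. -/
def regularizer (lam : ℝ) (ψ : Cutoff d) (n : ℤ) (t : ℝ) (φ : L2 d) : L2 d :=
  fourierMul _ (bddSymbol_cutoff ψ (|(n : ℝ)| * t ^ ((1 - 2 * lam) / 2))⁻¹) φ

/-- The operator `𝒢_n(t) = 𝒜_n(t) e^{i B_n(t) Δ} 𝒟(C_n(t)) 𝒦`, where `𝒜_n(t)` is the multiplication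
by `(1 + i t A_n'(t) |x|²)⁻¹`. -/
def opG (lam : ℝ) (ζ₁ ζ₂ : ℝ → ℝ) (ψ : Cutoff d) (n : ℤ) (t : ℝ) (φ : L2 d) : L2 d :=
  regOp t (deriv (coeffA ζ₁ ζ₂ n) t)
    (expLap (coeffB ζ₁ ζ₂ n t)
      (dilation (coeffC ζ₁ ζ₂ n t) (regularizer lam ψ n t φ)))

/-! ### Norms -/

/-- The homogeneous Sobolev norm `‖|∇|^δ φ‖₂`, with values in `[0, ∞]`. -/
def hSobNorm (δ : ℝ) (φ : L2 d) : ℝ≥0∞ :=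
  eLpNorm (fun ξ => (((2 * Real.pi * ‖ξ‖) ^ δ : ℝ) : ℂ) * (𝓕 φ : L2 d) ξ) 2 volume

/-- The weighted norm `‖|ξ|^{-δ} φ‖₂`, with values in `[0, ∞]`. -/
def weightedNorm (δ : ℝ) (φ : L2 d) : ℝ≥0∞ :=
  eLpNorm (fun ξ => ((‖ξ‖ ^ (-δ) : ℝ) : ℂ) * φ ξ) 2 volume

end TDHarmonic

end

/-!
The operator `𝒢_n(t)` first localizes to frequencies `≲ |n| N`, `N = t^{ρ/2}`, then dilates by
`C = C_n(t)`, applies the unitary group `e^{iBΔ}`, and multiplies by `w(x) = (1 + i a |x|²)⁻¹`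
with `a = t A_n'(t)`. Moving the dilation through the Fourier multipliers gives
`𝒢_n(t) φ = w · m(-i∇) Φ`, where `Φ = 𝒟(C) φ` and `m(ξ) = e^{-iB|ξ|²} ψ₀(Cξ/(|n|N))` (`opG_eq`).

*Coefficients.* Asymptotically `ζ₁ ~ t^λ` and `ζ₂ ~ t^{1-λ}` are positive and increasing, and `ζ₂`
is concave. The Wronskian relation `ζ₁ ζ₂' - ζ₁' ζ₂ = 1` then gives `ζ₁ ζ₂' ≥ 1`, whence
`|n| ≤ |C_n| ≲ |n|`, and also `A_n' = (n - 1) (n ζ₂'² - σ ζ₂²) / (2 C_n²)`. The asymptotic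
constants of `ζ₂`, `ζ₂'`, `ζ₂''` satisfy relations of l'Hôpital type, by which
`0 ≤ σ ζ₂² ≤ θ ζ₂'²` eventually, with `θ < 1` because `λ/(1-λ) < 1`. So `|a|` is of size `N²` for
all `n` simultaneously, and `|B_n| ≲ |n| N⁻²` (`TimeDecay.exists_coeff_bounds`).

*The estimate in `L²`.* With `s = √|a|` of size `N` and `μ = N |n|^{-1/2}`, the symbol satisfies
`|m(ξ) - 1| ≲ min(1, |ξ/μ|²)`. In the decomposition `w m(-i∇) Φ = w Φ + w (m - 1)(-i∇) Φ`, the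
first term is bounded through `|w| ≤ (s|x|)^{-δ}`. In the second term `w` is square integrable, as
`d < 4`, and `(m - 1)(-i∇) Φ` is bounded by Cauchy–Schwarz on the Fourier side, as `d/2 < δ ≤ 2`
(`exists_eLpNorm_mulOp_regFun_le`). The factor `|n|^κ` is the loss `(N/μ)^{δ-d/2}`.

*The estimate in `L^r`.* Since `e^{-iBΔ}` preserves the modulus of the Fourier transform, it
suffices for `r = ∞` to bound the `L¹` norm of the Fourier transform of `h = w m(-i∇) Φ`. As
`(1 + |ξ/s|²)⁻¹` is square integrable, this follows from an `L²` bound of `h - s⁻² Δh`. The symbol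
`m` is supported in `|ξ| ≲ s`, so every derivative costs a factor `s`
(`exists_eLpNorm_one_fourier_le`). The general case follows by interpolation with `L²`.
-/

noncomputable section

namespace TDHarmonic

variable {d : ℕ}

/-! ### Scaling of Lebesgue norms -/

theorem quasiMeasurePreserving_const_smul {c : ℝ} (hc : c ≠ 0) :
    Measure.QuasiMeasurePreserving (fun x : EuclideanSpace ℝ (Fin d) => c • x) := by
  refine ⟨measurable_const_smul c, ?_⟩
  rw [Measure.map_addHaar_smul _ hc]
  exact Measure.smul_absolutelyContinuous

theorem eLpNorm_comp_const_smul {F : Type*} [NormedAddCommGroup F]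
    {f : EuclideanSpace ℝ (Fin d) → F} (hf : AEStronglyMeasurable f volume) {c : ℝ} (hc : c ≠ 0) :
    eLpNorm (fun x => f (c • x)) 2 volume = ENNReal.ofReal (|c| ^ (-(d / 2 : ℝ))) *
      eLpNorm f 2 volume := by
  have hmap := Measure.map_addHaar_smul (volume : Measure (EuclideanSpace ℝ (Fin d))) hc
  have h1 : eLpNorm f 2 (Measure.map (fun x : EuclideanSpace ℝ (Fin d) => c • x) volume) =
      eLpNorm (fun x => f (c • x)) 2 volume :=
    eLpNorm_map_measure (hf.mono_ac (quasiMeasurePreserving_const_smul hc).absolutelyContinuous)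
      (measurable_const_smul c).aemeasurable
  rw [← h1, hmap, eLpNorm_smul_measure_of_ne_top (by norm_num), smul_eq_mul]
  congr 1
  have hc' : 0 < |c| := abs_pos.2 hc
  rw [ENNReal.ofReal_rpow_of_nonneg (abs_nonneg _) (by positivity)]
  congr 1
  rw [abs_inv, abs_pow, ← Real.rpow_natCast, ← Real.rpow_neg hc'.le, ← Real.rpow_mul hc'.le]
  congr 1
  simp
  ring

/-! ### The Fourier transform on `L²` -/

/-- An `L²` function is determined by the tempered distribution it defines. -/
theorem L2_ext_of_toTemperedDistribution_eq {u v : L2 d}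
    (h : Lp.toTemperedDistribution u = Lp.toTemperedDistribution v) : u = v := by
  have hker := Lp.ker_toTemperedDistributionCLM_eq_bot (E := EuclideanSpace ℝ (Fin d)) (F := ℂ)
    (μ := volume) (p := 2)
  have hz : Lp.toTemperedDistributionCLM ℂ (volume : Measure (EuclideanSpace ℝ (Fin d))) 2 (u - v)
      = 0 := by
    rw [map_sub, Lp.toTemperedDistributionCLM_apply, Lp.toTemperedDistributionCLM_apply, h,
      sub_self]
  exact sub_eq_zero.1 ((LinearMap.ker_eq_bot'.1 hker) _ hz)

/-- On integrable functions the `L²` inverse Fourier transform is given by the usual integral. -/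
theorem coeFn_fourierInv_of_integrable (u : L2 d) (hu : Integrable u volume) :
    (𝓕⁻ u : L2 d) =ᵐ[volume] 𝓕⁻ (u : EuclideanSpace ℝ (Fin d) → ℂ) := by
  have hcont : Continuous (𝓕⁻ (u : EuclideanSpace ℝ (Fin d) → ℂ)) :=
    VectorFourier.fourierIntegral_continuous Real.continuous_fourierChar
      (L := -innerₗ (EuclideanSpace ℝ (Fin d))) (by
        simp only [LinearMap.neg_apply, innerₗ_apply_apply]; fun_prop) hu
  refine ae_eq_of_integral_contDiff_smul_eq ((Lp.memLp _).locallyIntegrable (by norm_num))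
    hcont.locallyIntegrable fun g hg hgc => ?_
  have hg₁ : HasCompactSupport (Complex.ofRealCLM ∘ g) := hgc.comp_left rfl
  have hg₂ : ContDiff ℝ ∞ (Complex.ofRealCLM ∘ g) := by fun_prop
  set χ := hg₁.toSchwartzMap hg₂ with hχ
  have hχx : ∀ x, χ x = (g x : ℂ) := fun x => rfl
  have h1 := congrArg (fun T => T χ) (Lp.fourierInv_toTemperedDistribution_eq u)
  simp only [TemperedDistribution.fourierInv_apply, Lp.toTemperedDistribution_apply] at h1
  have h2 := VectorFourier.integral_fourierIntegral_smul_eq_flip (μ := volume) (ν := volume)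
    (L := -innerₗ (EuclideanSpace ℝ (Fin d))) (f := χ) (g := u)
    Real.continuous_fourierChar
    (by simp only [LinearMap.neg_apply, innerₗ_apply_apply]; fun_prop) χ.integrable hu
  have hflip : (-innerₗ (EuclideanSpace ℝ (Fin d))).flip = -innerₗ (EuclideanSpace ℝ (Fin d)) := by
    ext x y
    simp [real_inner_comm]
  rw [hflip] at h2
  calc ∫ x, g x • (𝓕⁻ u : L2 d) x = ∫ x, χ x • (𝓕⁻ u : L2 d) x := by simp [hχx]
    _ = ∫ x, (𝓕⁻ χ) x • u x := h1.symm
    _ = ∫ x, χ x • (𝓕⁻ (u : EuclideanSpace ℝ (Fin d) → ℂ)) x := by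
      rw [SchwartzMap.fourierInv_coe]; exact h2
    _ = _ := by simp [hχx]

/-- Both sides may be infinite. -/
theorem eLpNorm_top_fourierInv_le (u : L2 d) :
    eLpNorm (𝓕⁻ u : L2 d) ⊤ volume ≤ eLpNorm u 1 volume := by
  by_cases hu : eLpNorm u 1 volume = ⊤
  · simp [hu]
  have hint : Integrable u volume :=
    memLp_one_iff_integrable.1 ⟨(Lp.memLp u).1, lt_top_iff_ne_top.2 hu⟩
  rw [eLpNorm_congr_ae (coeFn_fourierInv_of_integrable u hint), eLpNorm_exponent_top]
  refine eLpNormEssSup_le_of_ae_enorm_bound (ae_of_all _ fun x => ?_)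
  rw [Real.fourierInv_eq, eLpNorm_one_eq_lintegral_enorm]
  refine (enorm_integral_le_lintegral_enorm _).trans (le_of_eq ?_)
  refine lintegral_congr fun y => ?_
  rw [Circle.smul_def, enorm_smul, ← ofReal_norm (Real.fourierChar _ : ℂ), Circle.norm_coe,
    ENNReal.ofReal_one, one_mul]

theorem coeFn_mulOp (m : EuclideanSpace ℝ (Fin d) → ℂ) (hm : BddSymbol m) (φ : L2 d) :
    mulOp m hm φ =ᵐ[volume] fun x => m x * φ x :=
  MemLp.coeFn_toLp _

theorem coeFn_fourier_fourierMul (m : EuclideanSpace ℝ (Fin d) → ℂ) (hm : BddSymbol m) (φ : L2 d) :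
    (𝓕 (fourierMul m hm φ) : L2 d) =ᵐ[volume] fun ξ => m ((2 * Real.pi) • ξ) * (𝓕 φ : L2 d) ξ := by
  rw [fourierMul, FourierTransform.fourier_fourierInv_eq]
  exact coeFn_mulOp _ _ _

theorem fourier_L2_injective : Function.Injective (fun φ : L2 d => (𝓕 φ : L2 d)) := fun u v h => by
  have := congrArg (fun φ : L2 d => (𝓕⁻ φ : L2 d)) h
  simpa using this

theorem L2_ext_of_fourier {u v : L2 d}
    (h : (𝓕 u : L2 d) =ᵐ[volume] (𝓕 v : L2 d)) : u = v :=
  fourier_L2_injective (Lp.ext h)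

theorem eLpNorm_fourier (φ : L2 d) :
    eLpNorm (𝓕 φ : L2 d) 2 volume = eLpNorm φ 2 volume := by
  have h := Lp.norm_fourier_eq φ
  rw [Lp.norm_def, Lp.norm_def] at h
  exact (ENNReal.toReal_eq_toReal_iff' (Lp.eLpNorm_ne_top _) (Lp.eLpNorm_ne_top _)).1 h

theorem fourierMul_fourierMul (m₁ m₂ : EuclideanSpace ℝ (Fin d) → ℂ) (h₁ : BddSymbol m₁)
    (h₂ : BddSymbol m₂) (h : BddSymbol fun ξ => m₁ ξ * m₂ ξ) (φ : L2 d) :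
    fourierMul m₁ h₁ (fourierMul m₂ h₂ φ) = fourierMul _ h φ := by
  refine L2_ext_of_fourier ?_
  filter_upwards [coeFn_fourier_fourierMul m₁ h₁ (fourierMul m₂ h₂ φ),
    coeFn_fourier_fourierMul m₂ h₂ φ, coeFn_fourier_fourierMul _ h φ] with ξ e₁ e₂ e₃
  rw [e₁, e₂, e₃, mul_assoc]

/-! ### Dilations -/

theorem coeFn_dilation {τ : ℝ} (hτ : τ ≠ 0) (φ : L2 d) :
    dilation τ φ =ᵐ[volume]
      fun x => (Complex.I * (τ : ℂ)) ^ (-((d : ℂ) / 2)) * φ (τ⁻¹ • x) := by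
  rw [dilation, dif_pos hτ]
  exact MemLp.coeFn_toLp _

theorem norm_dilation_factor {τ : ℝ} :
    ‖(Complex.I * (τ : ℂ)) ^ (-((d : ℂ) / 2))‖ = |τ| ^ (-(d / 2 : ℝ)) := by
  have : (-((d : ℂ) / 2)) = ((-(d / 2 : ℝ) : ℝ) : ℂ) := by push_cast; ring
  rw [this, Complex.norm_cpow_real]
  simp

theorem fourier_comp_const_smul (χ : EuclideanSpace ℝ (Fin d) → ℂ) {τ : ℝ} (hτ : τ ≠ 0)
    (y : EuclideanSpace ℝ (Fin d)) :
    𝓕 (fun x => χ (τ⁻¹ • x)) y = (|τ| ^ d : ℝ) * 𝓕 χ (τ • y) := by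
  rw [Real.fourier_eq, Real.fourier_eq]
  have h := Measure.integral_comp_smul (volume : Measure (EuclideanSpace ℝ (Fin d)))
    (fun v => Real.fourierChar (-inner ℝ v (τ • y)) • χ v) τ⁻¹
  have e : ∀ v : EuclideanSpace ℝ (Fin d), inner ℝ (τ⁻¹ • v) (τ • y) = inner ℝ v y := fun v => by
    rw [inner_smul_left, inner_smul_right]
    simp [hτ]
  simp only [e] at h
  rw [h]
  simp [abs_pow]

/-- The Fourier transform of a dilated `L²` function, obtained by testing against dilated Schwartz
functions. -/
theorem coeFn_fourier_dilation {τ : ℝ} (hτ : τ ≠ 0) (φ : L2 d) :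
    (𝓕 (dilation τ φ) : L2 d) =ᵐ[volume] fun ξ =>
      (Complex.I * (τ : ℂ)) ^ (-((d : ℂ) / 2)) * ((|τ| ^ d : ℝ) * (𝓕 φ : L2 d) (τ • ξ)) := by
  set k := (Complex.I * (τ : ℂ)) ^ (-((d : ℂ) / 2)) with hk
  have hmem : MemLp (fun ξ => k * ((|τ| ^ d : ℝ) * (𝓕 φ : L2 d) (τ • ξ))) 2 volume := by
    refine (MemLp.const_mul (MemLp.const_mul ?_ _) _)
    refine ⟨(Lp.memLp _).1.comp_quasiMeasurePreserving (quasiMeasurePreserving_const_smul hτ), ?_⟩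
    rw [eLpNorm_comp_const_smul (Lp.memLp _).1 hτ]
    exact ENNReal.mul_lt_top ENNReal.ofReal_lt_top (Lp.eLpNorm_lt_top _)
  refine ae_eq_of_integral_contDiff_smul_eq ((Lp.memLp _).locallyIntegrable (by norm_num))
    (hmem.locallyIntegrable (by norm_num)) fun g hg hgc => ?_
  have hg₁ : HasCompactSupport (Complex.ofRealCLM ∘ g) := hgc.comp_left rfl
  have hg₂ : ContDiff ℝ ∞ (Complex.ofRealCLM ∘ g) := by fun_prop
  set χ := hg₁.toSchwartzMap hg₂ with hχ
  have hχx : ∀ x, χ x = (g x : ℂ) := fun x => rfl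
  -- the test function `χ (τ⁻¹ • x)`
  set χ' := SchwartzMap.compCLMOfContinuousLinearEquiv ℂ
    (ContinuousLinearEquiv.smulLeft (R₁ := ℝ) (M₁ := EuclideanSpace ℝ (Fin d))
      (Units.mk0 τ⁻¹ (inv_ne_zero hτ))) χ with hχ'
  have hχ'x : (χ' : EuclideanSpace ℝ (Fin d) → ℂ) = fun x => χ (τ⁻¹ • x) := by
    ext x
    rfl
  have h1 := congrArg (fun T => T χ) (Lp.fourier_toTemperedDistribution_eq (dilation τ φ))
  have h2 := congrArg (fun T => T χ') (Lp.fourier_toTemperedDistribution_eq φ)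
  simp only [TemperedDistribution.fourier_apply, Lp.toTemperedDistribution_apply] at h1 h2
  have h3 := Measure.integral_comp_smul (volume : Measure (EuclideanSpace ℝ (Fin d)))
    (fun v => (𝓕 χ) (τ • v) * φ v) τ⁻¹
  have h4 := Measure.integral_comp_smul (volume : Measure (EuclideanSpace ℝ (Fin d)))
    (fun v => χ (τ⁻¹ • v) * (𝓕 φ : L2 d) v) τ
  have habs : (|τ| ^ d : ℂ) ≠ 0 := by
    exact_mod_cast (pow_pos (abs_pos.2 hτ) d).ne'
  simp only [inv_pow, inv_inv, finrank_euclideanSpace, Fintype.card_fin, abs_pow, smul_smul,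
    mul_inv_cancel₀ hτ, inv_mul_cancel₀ hτ, one_smul, abs_inv, Complex.real_smul] at h3 h4
  calc ∫ x, g x • (𝓕 (dilation τ φ) : L2 d) x = ∫ x, χ x • (𝓕 (dilation τ φ) : L2 d) x := by
        simp [hχx]
    _ = ∫ x, (𝓕 χ) x • (dilation τ φ) x := h1.symm
    _ = ∫ x, k * ((𝓕 χ) x * φ (τ⁻¹ • x)) := by
        refine integral_congr_ae ?_
        filter_upwards [coeFn_dilation hτ φ] with x hx
        rw [hx, smul_eq_mul]; ring
    _ = k * ∫ v, (𝓕 χ') v • φ v := by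
        rw [integral_const_mul, h3, ← integral_const_mul]
        congr 2
        ext v
        rw [SchwartzMap.fourier_coe χ', hχ'x, fourier_comp_const_smul _ hτ, SchwartzMap.fourier_coe]
        push_cast
        simp [mul_assoc]
    _ = k * ∫ v, χ (τ⁻¹ • v) * (𝓕 φ : L2 d) v := by rw [h2, hχ'x]; rfl
    _ = k * ((|τ| ^ d : ℝ) * ∫ v, χ v * (𝓕 φ : L2 d) (τ • v)) := by
        rw [h4]
        push_cast
        rw [mul_inv_cancel_left₀ habs]
    _ = _ := by
        rw [← integral_const_mul, ← integral_const_mul]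
        congr 1
        ext x
        rw [hχx, Complex.real_smul]
        ring

theorem dilation_fourierMul {τ : ℝ} (hτ : τ ≠ 0) (m : EuclideanSpace ℝ (Fin d) → ℂ)
    (hm : BddSymbol m) (φ : L2 d) :
    dilation τ (fourierMul m hm φ) = fourierMul _ (hm.comp_smul τ) (dilation τ φ) := by
  refine L2_ext_of_fourier ?_
  filter_upwards [coeFn_fourier_dilation hτ (fourierMul m hm φ), coeFn_fourier_dilation hτ φ,
    coeFn_fourier_fourierMul _ (hm.comp_smul τ) (dilation τ φ),
    (quasiMeasurePreserving_const_smul hτ).ae (coeFn_fourier_fourierMul m hm φ)] with ξ e₁ e₂ e₃ e₄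
  rw [e₁, e₃, e₂, e₄, smul_comm τ]
  ring

theorem hSobNorm_dilation (δ : ℝ) {τ : ℝ} (hτ : τ ≠ 0) (φ : L2 d) :
    hSobNorm δ (dilation τ φ) = ENNReal.ofReal (|τ| ^ (-δ)) * hSobNorm δ φ := by
  have hτ' : 0 < |τ| := abs_pos.2 hτ
  set F : EuclideanSpace ℝ (Fin d) → ℂ :=
    fun ξ => (((2 * Real.pi * ‖ξ‖) ^ δ : ℝ) : ℂ) * (𝓕 φ : L2 d) ξ with hF
  have hFm : AEStronglyMeasurable F volume := by
    refine AEStronglyMeasurable.mul ?_ (Lp.memLp _).1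
    exact (by fun_prop : Measurable fun ξ : EuclideanSpace ℝ (Fin d) =>
      (((2 * Real.pi * ‖ξ‖) ^ δ : ℝ) : ℂ)).aestronglyMeasurable
  have h : (fun ξ => (((2 * Real.pi * ‖ξ‖) ^ δ : ℝ) : ℂ) * (𝓕 (dilation τ φ) : L2 d) ξ) =ᵐ[volume]
      ((Complex.I * (τ : ℂ)) ^ (-((d : ℂ) / 2)) * ((|τ| ^ d * |τ| ^ (-δ) : ℝ) : ℂ)) •
        fun ξ => F (τ • ξ) := by
    filter_upwards [coeFn_fourier_dilation hτ φ] with ξ e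
    rw [e, Pi.smul_apply, hF]
    simp only [norm_smul, Real.norm_eq_abs, smul_eq_mul]
    have e2 : (2 * Real.pi * (|τ| * ‖ξ‖)) ^ δ = |τ| ^ δ * (2 * Real.pi * ‖ξ‖) ^ δ := by
      rw [← Real.mul_rpow hτ'.le (by positivity)]
      ring_nf
    have e3 : |τ| ^ (-δ) * |τ| ^ δ = 1 := by
      rw [← Real.rpow_add hτ']; simp
    rw [e2]
    have e4 : ((|τ| ^ (-δ) : ℝ) : ℂ) * ((|τ| ^ δ : ℝ) : ℂ) = 1 := by exact_mod_cast e3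
    push_cast at e4 ⊢
    linear_combination (-(Complex.I * (τ : ℂ)) ^ (-((d : ℂ) / 2)) * ((|τ| : ℝ) : ℂ) ^ d *
      (((2 * Real.pi * ‖ξ‖) ^ δ : ℝ) : ℂ) * (𝓕 φ : L2 d) (τ • ξ)) * e4
  rw [hSobNorm, eLpNorm_congr_ae h, eLpNorm_const_smul, eLpNorm_comp_const_smul hFm hτ, ← mul_assoc,
    hSobNorm]
  congr 1
  rw [← ofReal_norm, norm_mul, norm_dilation_factor, Complex.norm_real,
    Real.norm_of_nonneg (by positivity), ← ENNReal.ofReal_mul (by positivity)]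
  congr 1
  rw [← Real.rpow_natCast, ← Real.rpow_add hτ', ← Real.rpow_add hτ', ← Real.rpow_add hτ']
  congr 1
  ring

theorem weightedNorm_dilation (δ : ℝ) {τ : ℝ} (hτ : τ ≠ 0) (φ : L2 d) :
    weightedNorm δ (dilation τ φ) = ENNReal.ofReal (|τ| ^ (-δ)) * weightedNorm δ φ := by
  have hτ' : 0 < |τ| := abs_pos.2 hτ
  set F : EuclideanSpace ℝ (Fin d) → ℂ := fun ξ => ((‖ξ‖ ^ (-δ) : ℝ) : ℂ) * φ ξ with hF
  have hFm : AEStronglyMeasurable F volume := by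
    refine AEStronglyMeasurable.mul ?_ (Lp.memLp _).1
    exact (by fun_prop : Measurable fun ξ : EuclideanSpace ℝ (Fin d) =>
      ((‖ξ‖ ^ (-δ) : ℝ) : ℂ)).aestronglyMeasurable
  have h : (fun ξ => ((‖ξ‖ ^ (-δ) : ℝ) : ℂ) * (dilation τ φ) ξ) =ᵐ[volume]
      ((Complex.I * (τ : ℂ)) ^ (-((d : ℂ) / 2)) * ((|τ| ^ (-δ) : ℝ) : ℂ)) •
        fun ξ => F (τ⁻¹ • ξ) := by
    filter_upwards [coeFn_dilation hτ φ] with ξ e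
    rw [e, Pi.smul_apply, hF]
    simp only [norm_smul, Real.norm_eq_abs, smul_eq_mul]
    have e2 : ‖ξ‖ ^ (-δ) = |τ| ^ (-δ) * (|τ⁻¹| * ‖ξ‖) ^ (-δ) := by
      rw [← Real.mul_rpow hτ'.le (by positivity), abs_inv, mul_inv_cancel_left₀ hτ'.ne']
    rw [e2]
    push_cast
    ring
  rw [weightedNorm, eLpNorm_congr_ae h, eLpNorm_const_smul,
    eLpNorm_comp_const_smul hFm (inv_ne_zero hτ), ← mul_assoc, weightedNorm]
  congr 1
  rw [← ofReal_norm, norm_mul, norm_dilation_factor, Complex.norm_real,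
    Real.norm_of_nonneg (by positivity), ← ENNReal.ofReal_mul (by positivity)]
  congr 1
  rw [abs_inv, Real.inv_rpow hτ'.le, ← Real.rpow_neg hτ'.le, ← Real.rpow_add hτ',
    ← Real.rpow_add hτ']
  congr 1
  ring

/-! ### Square integrability of the weights -/

theorem memLp_inv_one_add_norm_sq (hd : d < 4) :
    MemLp (fun x : EuclideanSpace ℝ (Fin d) => (1 + ‖x‖ ^ 2)⁻¹) 2 volume := by
  refine (memLp_two_iff_integrable_sq (by fun_prop)).2 ?_
  have h := integrable_rpow_neg_one_add_norm_sq (E := EuclideanSpace ℝ (Fin d)) (μ := volume)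
    (r := 4) (by simpa using (by exact_mod_cast hd : (d : ℝ) < 4))
  refine h.congr (ae_of_all _ fun x => ?_)
  have hx : 0 < 1 + ‖x‖ ^ 2 := by positivity
  change (1 + ‖x‖ ^ 2) ^ (-4 / 2 : ℝ) = ((1 + ‖x‖ ^ 2)⁻¹) ^ 2
  rw [show (-4 / 2 : ℝ) = -((2 : ℕ) : ℝ) by norm_num, Real.rpow_neg hx.le, Real.rpow_natCast,
    inv_pow]

theorem memLp_min_mul_rpow {δ : ℝ} (h₁ : (d : ℝ) / 2 < δ) (h₂ : δ ≤ 2) :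
    MemLp (fun x : EuclideanSpace ℝ (Fin d) => min 1 (‖x‖ ^ 2) * ‖x‖ ^ (-δ)) 2 volume := by
  have hδ : 0 < δ := lt_of_le_of_lt (by positivity) h₁
  refine (memLp_two_iff_integrable_sq (by fun_prop : Measurable _).aestronglyMeasurable).2 ?_
  have h := integrable_rpow_neg_one_add_norm_sq (E := EuclideanSpace ℝ (Fin d)) (μ := volume)
    (r := 2 * δ) (by rw [finrank_euclideanSpace, Fintype.card_fin]; linarith)
  refine (h.const_mul (2 ^ δ)).mono' (by fun_prop : Measurable _).aestronglyMeasurable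
    (ae_of_all _ fun x => ?_)
  have hx : 0 < 1 + ‖x‖ ^ 2 := by positivity
  rw [Real.norm_of_nonneg (by positivity), show -(2 * δ) / 2 = -δ by ring, Real.rpow_neg hx.le,
    ← div_eq_mul_inv, ← Real.div_rpow (by norm_num) hx.le]
  rcases le_total ‖x‖ 1 with h1 | h1
  · have hle : 1 ≤ (2 / (1 + ‖x‖ ^ 2)) ^ δ := by
      refine Real.one_le_rpow ?_ hδ.le
      rw [le_div_iff₀ hx]
      nlinarith [norm_nonneg x]
    refine le_trans (pow_le_one₀ (by positivity) ?_) hle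
    rw [min_eq_right (by nlinarith [norm_nonneg x])]
    rcases eq_or_lt_of_le (norm_nonneg x) with h0 | h0
    · rw [← h0]; simp
    · rw [← Real.rpow_natCast, ← Real.rpow_add h0]
      exact Real.rpow_le_one h0.le h1 (by push_cast; linarith)
  · rw [min_eq_left (by nlinarith), one_mul, ← Real.rpow_natCast, ← Real.rpow_mul (by linarith),
      show -δ * ((2 : ℕ) : ℝ) = ((2 : ℕ) : ℝ) * (-δ) by ring, Real.rpow_mul (by linarith),
      Real.rpow_natCast, Real.rpow_neg (by positivity), ← Real.inv_rpow (by positivity)]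
    refine Real.rpow_le_rpow (by positivity) ?_ hδ.le
    rw [le_div_iff₀ hx, inv_mul_le_iff₀ (by positivity)]
    nlinarith

theorem memLp_indicator_rpow (hd : 1 ≤ d) {δ : ℝ} (h₁ : δ < 1 + (d : ℝ) / 2) :
    MemLp (fun x : EuclideanSpace ℝ (Fin d) => if ‖x‖ ≤ 1 then ‖x‖ ^ (1 - δ) else 0) 2 volume := by
  have hmeas : Measurable fun x : EuclideanSpace ℝ (Fin d) =>
      if ‖x‖ ≤ 1 then ‖x‖ ^ (1 - δ) else 0 :=
    Measurable.ite (measurableSet_le measurable_norm measurable_const) (by fun_prop)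
      measurable_const
  refine (memLp_two_iff_integrable_sq hmeas.aestronglyMeasurable).2 ?_
  have : Nonempty (Fin d) := ⟨⟨0, hd⟩⟩
  refine (integrable_fun_norm_addHaar (volume : Measure (EuclideanSpace ℝ (Fin d)))
    (f := fun y : ℝ => (if y ≤ 1 then y ^ (1 - δ) else 0) ^ 2)).2 ?_
  have h0 : IntegrableOn (fun y : ℝ => y ^ ((d : ℝ) + 1 - 2 * δ)) (Ioc 0 1) volume := by
    rw [integrableOn_Ioc_iff_integrableOn_Ioo]
    exact (intervalIntegral.integrableOn_Ioo_rpow_iff one_pos).2 (by linarith)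
  rw [← Ioc_union_Ioi_eq_Ioi (zero_le_one (α := ℝ)), integrableOn_union]
  constructor
  · refine h0.congr_fun (fun y hy => ?_) measurableSet_Ioc
    have hy0 : 0 < y := hy.1
    simp only [hy.2, if_true, finrank_euclideanSpace, Fintype.card_fin, smul_eq_mul]
    rw [← Real.rpow_natCast, ← Real.rpow_natCast, ← Real.rpow_mul hy0.le, ← Real.rpow_add hy0]
    congr 1
    push_cast [hd]
    ring
  · refine integrableOn_zero.congr_fun (fun y hy => ?_) measurableSet_Ioi
    have : ¬ y ≤ 1 := not_le.2 hy
    simp [this]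

/-! ### The multiplier estimate -/

/-- If `|m(ξ)| |ξ|^{-δ} ≤ F(ξ)` with `F` square integrable, then `m(-i∇)` maps `Ḣ^δ` into `L^∞`:
Cauchy-Schwarz on the Fourier side. -/
theorem eLpNorm_top_fourierMul_le (hd : 1 ≤ d) {δ : ℝ} {m : EuclideanSpace ℝ (Fin d) → ℂ}
    (hm : BddSymbol m) {F : EuclideanSpace ℝ (Fin d) → ℝ} (hF : Measurable F)
    (hmF : ∀ ξ, ξ ≠ 0 → ‖m ξ‖ * ‖ξ‖ ^ (-δ) ≤ F ξ) (Φ : L2 d) :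
    eLpNorm (fourierMul m hm Φ) ⊤ volume ≤ eLpNorm F 2 volume * hSobNorm δ Φ := by
  have : Nonempty (Fin d) := ⟨⟨0, hd⟩⟩
  refine (eLpNorm_top_fourierInv_le _).trans ?_
  have h2π : (2 * Real.pi) ≠ 0 := by positivity
  have hS : AEStronglyMeasurable
      (fun ξ => (((2 * Real.pi * ‖ξ‖) ^ δ : ℝ) : ℂ) * (𝓕 Φ : L2 d) ξ) volume := by
    refine AEStronglyMeasurable.mul ?_ (Lp.memLp _).1
    exact (by fun_prop : Measurable fun ξ : EuclideanSpace ℝ (Fin d) =>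
      (((2 * Real.pi * ‖ξ‖) ^ δ : ℝ) : ℂ)).aestronglyMeasurable
  calc eLpNorm (mulOp (fun ξ => m ((2 * Real.pi) • ξ)) (hm.comp_smul _) (𝓕 Φ)) 1 volume
      ≤ eLpNorm ((fun ξ => F ((2 * Real.pi) • ξ)) •
          fun ξ => (((2 * Real.pi * ‖ξ‖) ^ δ : ℝ) : ℂ) * (𝓕 Φ : L2 d) ξ) 1 volume := by
        refine eLpNorm_mono_ae ?_
        have h0 : ∀ᵐ ξ : EuclideanSpace ℝ (Fin d), ξ ≠ 0 := by
          simp [ae_iff, measure_singleton]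
        filter_upwards [coeFn_mulOp _ (hm.comp_smul (2 * Real.pi)) (𝓕 Φ), h0] with ξ e hξ
        have hξ' : 0 < 2 * Real.pi * ‖ξ‖ := by positivity
        have := hmF ((2 * Real.pi) • ξ) (smul_ne_zero h2π hξ)
        rw [norm_smul, Real.norm_of_nonneg (by positivity : (0 : ℝ) ≤ 2 * Real.pi)] at this
        rw [e, Pi.smul_apply', norm_smul, norm_mul, norm_mul, Complex.norm_real,
          Real.norm_of_nonneg (by positivity : 0 ≤ (2 * Real.pi * ‖ξ‖) ^ δ), ← mul_assoc]
        gcongr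
        calc ‖m ((2 * Real.pi) • ξ)‖
            = ‖m ((2 * Real.pi) • ξ)‖ * (2 * Real.pi * ‖ξ‖) ^ (-δ) * (2 * Real.pi * ‖ξ‖) ^ δ := by
              rw [mul_assoc, ← Real.rpow_add hξ']; simp
          _ ≤ F ((2 * Real.pi) • ξ) * (2 * Real.pi * ‖ξ‖) ^ δ := by gcongr
          _ ≤ _ := by gcongr; exact le_abs_self _
    _ ≤ eLpNorm (fun ξ => F ((2 * Real.pi) • ξ)) 2 volume * hSobNorm δ Φ :=
        eLpNorm_smul_le_mul_eLpNorm hS (hF.comp (measurable_const_smul _)).aestronglyMeasurable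
    _ ≤ eLpNorm F 2 volume * hSobNorm δ Φ := by
        gcongr
        rw [eLpNorm_comp_const_smul hF.aestronglyMeasurable h2π]
        refine mul_le_of_le_one_left' ?_
        rw [ENNReal.ofReal_le_one, abs_of_pos (by positivity)]
        refine Real.rpow_le_one_of_one_le_of_nonpos ?_ (by
          have : (0 : ℝ) ≤ d / 2 := by positivity
          linarith)
        linarith [Real.pi_gt_three]

/-- Scaled form of `eLpNorm_top_fourierMul_le`. -/
theorem eLpNorm_top_fourierMul_le_scaled (hd : 1 ≤ d) {δ : ℝ} {m : EuclideanSpace ℝ (Fin d) → ℂ}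
    (hm : BddSymbol m) {G : EuclideanSpace ℝ (Fin d) → ℝ} (hG : Measurable G) {A R : ℝ}
    (hA : 0 ≤ A) (hR : 0 < R)
    (hmG : ∀ ξ, ξ ≠ 0 → ‖m ξ‖ * ‖ξ‖ ^ (-δ) ≤ A * G (R⁻¹ • ξ)) (Φ : L2 d) :
    eLpNorm (fourierMul m hm Φ) ⊤ volume ≤
      ENNReal.ofReal (A * R ^ (d / 2 : ℝ)) * eLpNorm G 2 volume * hSobNorm δ Φ := by
  refine (eLpNorm_top_fourierMul_le hd hm (F := A • fun ξ => G (R⁻¹ • ξ))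
    ((hG.comp (measurable_const_smul _)).const_smul A) hmG Φ).trans (le_of_eq ?_)
  rw [eLpNorm_const_smul, eLpNorm_comp_const_smul hG.aestronglyMeasurable (inv_ne_zero hR.ne'),
    ← mul_assoc, ENNReal.ofReal_mul hA, Real.enorm_of_nonneg hA, abs_of_pos (inv_pos.2 hR),
    Real.inv_rpow hR.le, ← Real.rpow_neg hR.le, neg_neg]

/-! ### The regularizing weight -/

/-- The weight `(1 + i a |x|²)⁻¹`. -/
def regFun (d : ℕ) (a : ℝ) (x : EuclideanSpace ℝ (Fin d)) : ℂ :=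
  (1 + Complex.I * ((a * ‖x‖ ^ 2 : ℝ) : ℂ))⁻¹

theorem bddSymbol_regFun (a : ℝ) : BddSymbol (regFun d a) := bddSymbol_reg a

theorem one_add_I_mul_ofReal_ne_zero (y : ℝ) : 1 + Complex.I * (y : ℂ) ≠ 0 := fun h => by
  have := congrArg Complex.re h
  simp at this

theorem norm_one_add_I_mul_ofReal_sq (y : ℝ) : ‖1 + Complex.I * (y : ℂ)‖ ^ 2 = 1 + y ^ 2 := by
  rw [← Complex.normSq_eq_norm_sq, Complex.normSq_apply]
  simp
  ring

theorem norm_regFun_sq (a : ℝ) (x : EuclideanSpace ℝ (Fin d)) :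
    ‖regFun d a x‖ ^ 2 = (1 + (a * ‖x‖ ^ 2) ^ 2)⁻¹ := by
  rw [regFun, norm_inv, inv_pow, norm_one_add_I_mul_ofReal_sq]

theorem norm_regFun_le_one (a : ℝ) (x : EuclideanSpace ℝ (Fin d)) : ‖regFun d a x‖ ≤ 1 := by
  refine (sq_le_one_iff₀ (norm_nonneg _)).1 ?_
  rw [norm_regFun_sq]
  exact inv_le_one_of_one_le₀ (by nlinarith [sq_nonneg (a * ‖x‖ ^ 2)])

theorem abs_mul_norm_regFun_le (a : ℝ) (x : EuclideanSpace ℝ (Fin d)) :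
    |a| * ‖x‖ ^ 2 * ‖regFun d a x‖ ≤ 1 := by
  refine (sq_le_one_iff₀ (by positivity)).1 ?_
  rw [mul_pow, norm_regFun_sq, ← div_eq_mul_inv, div_le_one (by positivity), mul_pow, mul_pow,
    sq_abs]
  linarith

theorem norm_regFun_le (a : ℝ) (x : EuclideanSpace ℝ (Fin d)) :
    ‖regFun d a x‖ ≤ 2 * (1 + ‖√|a| • x‖ ^ 2)⁻¹ := by
  rw [norm_smul, mul_pow, Real.norm_of_nonneg (Real.sqrt_nonneg _), Real.sq_sqrt (abs_nonneg _),
    ← div_eq_mul_inv, le_div_iff₀ (by positivity)]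
  nlinarith [norm_regFun_le_one a x, abs_mul_norm_regFun_le a x]

theorem norm_regFun_le_rpow {a : ℝ} (ha : a ≠ 0) {δ : ℝ} (h₀ : 0 ≤ δ) (h₂ : δ ≤ 2)
    {x : EuclideanSpace ℝ (Fin d)} (hx : x ≠ 0) :
    ‖regFun d a x‖ ≤ (√|a|) ^ (-δ) * ‖x‖ ^ (-δ) := by
  have hs : 0 < √|a| := Real.sqrt_pos.2 (abs_pos.2 ha)
  have hx' : 0 < ‖x‖ := norm_pos_iff.2 hx
  have hy : 0 < √|a| * ‖x‖ := by positivity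
  rw [← Real.mul_rpow hs.le hx'.le]
  have hb := abs_mul_norm_regFun_le a x
  have e : |a| * ‖x‖ ^ 2 = (√|a| * ‖x‖) ^ 2 := by rw [mul_pow, Real.sq_sqrt (abs_nonneg _)]
  rw [e] at hb
  set y := √|a| * ‖x‖
  rcases le_total y 1 with h | h
  · exact (norm_regFun_le_one a x).trans
      (Real.one_le_rpow_of_pos_of_le_one_of_nonpos hy h (by linarith))
  · calc ‖regFun d a x‖ ≤ (y ^ 2)⁻¹ := by
          rw [← one_div, le_div_iff₀ (by positivity)]; linarith
      _ = y ^ (-2 : ℝ) := by rw [Real.rpow_neg hy.le]; norm_cast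
      _ ≤ y ^ (-δ) := Real.rpow_le_rpow_of_exponent_le h (by linarith)

theorem eLpNorm_regFun_le {a : ℝ} (ha : a ≠ 0) :
    eLpNorm (regFun d a) 2 volume ≤ ENNReal.ofReal (2 * (√|a|) ^ (-(d / 2 : ℝ))) *
      eLpNorm (fun x : EuclideanSpace ℝ (Fin d) => (1 + ‖x‖ ^ 2)⁻¹) 2 volume := by
  have hs : 0 < √|a| := Real.sqrt_pos.2 (abs_pos.2 ha)
  refine (eLpNorm_mono_real (norm_regFun_le a)).trans (le_of_eq ?_)
  have := eLpNorm_const_smul (2 : ℝ) (fun x : EuclideanSpace ℝ (Fin d) => (1 + ‖√|a| • x‖ ^ 2)⁻¹) 2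
    volume
  refine this.trans ?_
  rw [eLpNorm_comp_const_smul (f := fun x : EuclideanSpace ℝ (Fin d) => (1 + ‖x‖ ^ 2)⁻¹)
    (by fun_prop : Measurable _).aestronglyMeasurable hs.ne', ← mul_assoc,
    ENNReal.ofReal_mul (by norm_num), abs_of_pos hs, Real.enorm_of_nonneg (by norm_num)]

/-! ### The weighted `L²` estimate -/

/-- The quantity `s^{-δ} ‖|x|^{-δ} Φ‖₂ + s^{-d/2} μ^{d/2-δ} ‖Φ‖_{Ḣ^δ}` that controls the regularized
functions, for a weight of scale `1/s` and a multiplier deviating from `1` at frequencies `≥ μ`. -/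
def scaledNorm (δ s μ : ℝ) (Φ : L2 d) : ℝ≥0∞ :=
  ENNReal.ofReal (s ^ (-δ)) * weightedNorm δ Φ +
    ENNReal.ofReal (s ^ (-(d / 2 : ℝ)) * μ ^ ((d / 2 : ℝ) - δ)) * hSobNorm δ Φ

theorem BddSymbol.sub_one {m : EuclideanSpace ℝ (Fin d) → ℂ} (hm : BddSymbol m) :
    BddSymbol fun ξ => m ξ - 1 := by
  obtain ⟨h, M, hM⟩ := hm
  exact ⟨h.sub_const 1, M + 1, fun x => (norm_sub_le _ _).trans (by simpa using hM x)⟩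

theorem fourierMul_eq_add (m : EuclideanSpace ℝ (Fin d) → ℂ) (hm : BddSymbol m) (Φ : L2 d) :
    fourierMul m hm Φ = Φ + fourierMul _ hm.sub_one Φ := by
  refine L2_ext_of_fourier ?_
  rw [FourierTransform.fourier_add]
  filter_upwards [coeFn_fourier_fourierMul m hm Φ, coeFn_fourier_fourierMul _ hm.sub_one Φ,
    Lp.coeFn_add (𝓕 Φ) (𝓕 (fourierMul _ hm.sub_one Φ))] with ξ e₁ e₂ e₃
  rw [e₃, Pi.add_apply, e₁, e₂]
  ring

/-- The regularized function is bounded by splitting `m(-i∇) Φ = Φ + (m(-i∇) - 1) Φ`. The weight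
is dominated by `(s |x|)^{-δ}` on the first part; the second part is bounded, as `m - 1` vanishes to
second order at the origin, and the weight is square integrable since `d < 4`. -/
theorem exists_eLpNorm_mulOp_regFun_le (hd1 : 1 ≤ d) (hd : d < 4) {δ : ℝ} (h₁ : (d : ℝ) / 2 < δ)
    (h₂ : δ ≤ 2) {K : ℝ} (hK : 0 ≤ K) :
    ∃ C : ℝ, 0 ≤ C ∧ ∀ (a μ : ℝ), a ≠ 0 → 0 < μ → ∀ (m : EuclideanSpace ℝ (Fin d) → ℂ)
      (hm : BddSymbol m), (∀ ξ, ‖m ξ - 1‖ ≤ K * min 1 (‖μ⁻¹ • ξ‖ ^ 2)) → ∀ Φ : L2 d,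
      eLpNorm (mulOp (regFun d a) (bddSymbol_regFun a) (fourierMul m hm Φ)) 2 volume ≤
        ENNReal.ofReal C * scaledNorm δ (√|a|) μ Φ := by
  have : Nonempty (Fin d) := ⟨⟨0, hd1⟩⟩
  have hδ : 0 < δ := lt_of_le_of_lt (by positivity) h₁
  set J := eLpNorm (fun x : EuclideanSpace ℝ (Fin d) => (1 + ‖x‖ ^ 2)⁻¹) 2 volume with hJ
  set Q := eLpNorm (fun x : EuclideanSpace ℝ (Fin d) => min 1 (‖x‖ ^ 2) * ‖x‖ ^ (-δ)) 2 volume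
    with hQ
  have hJt : J ≠ ⊤ := (memLp_inv_one_add_norm_sq hd).2.ne
  have hQt : Q ≠ ⊤ := (memLp_min_mul_rpow h₁ h₂).2.ne
  refine ⟨1 + 2 * J.toReal * K * Q.toReal, by positivity, fun a μ ha hμ m hm hmK Φ => ?_⟩
  have hs : 0 < √|a| := Real.sqrt_pos.2 (abs_pos.2 ha)
  set s := √|a| with hs'
  set f := fourierMul _ hm.sub_one Φ with hf
  have hsplit : mulOp (regFun d a) (bddSymbol_regFun a) (fourierMul m hm Φ) =ᵐ[volume]
      (fun x => regFun d a x * Φ x) + (fun x => regFun d a x * f x) := by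
    filter_upwards [coeFn_mulOp (regFun d a) (bddSymbol_regFun a) (fourierMul m hm Φ),
      Lp.coeFn_add Φ f] with x e₁ e₂
    rw [e₁, fourierMul_eq_add, e₂, Pi.add_apply, Pi.add_apply, mul_add]
  have hm₁ : AEStronglyMeasurable (fun x => regFun d a x * Φ x) volume :=
    (bddSymbol_regFun a).1.aestronglyMeasurable.mul (Lp.memLp _).1
  have hm₂ : AEStronglyMeasurable (fun x => regFun d a x * f x) volume :=
    (bddSymbol_regFun a).1.aestronglyMeasurable.mul (Lp.memLp _).1
  have hfirst : eLpNorm (fun x => regFun d a x * Φ x) 2 volume ≤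
      ENNReal.ofReal (s ^ (-δ)) * weightedNorm δ Φ := by
    have h0 : ∀ᵐ ξ : EuclideanSpace ℝ (Fin d), ξ ≠ 0 := by simp [ae_iff, measure_singleton]
    refine eLpNorm_le_mul_eLpNorm_of_ae_le_mul (h0.mono fun x hx => ?_) 2
    rw [norm_mul, norm_mul, ← mul_assoc, Complex.norm_real, Real.norm_of_nonneg (by positivity)]
    gcongr
    exact norm_regFun_le_rpow ha hδ.le h₂ hx
  have hsup : eLpNorm f ⊤ volume ≤
      ENNReal.ofReal (K * μ ^ (-δ) * μ ^ (d / 2 : ℝ)) * Q * hSobNorm δ Φ := by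
    refine eLpNorm_top_fourierMul_le_scaled hd1 hm.sub_one (by fun_prop) (by positivity) hμ
      (fun ξ hξ => ?_) Φ
    have hξ' : 0 < ‖ξ‖ := norm_pos_iff.2 hξ
    calc ‖m ξ - 1‖ * ‖ξ‖ ^ (-δ) ≤ K * min 1 (‖μ⁻¹ • ξ‖ ^ 2) * ‖ξ‖ ^ (-δ) := by
          gcongr
          exact hmK ξ
      _ = K * μ ^ (-δ) * (min 1 (‖μ⁻¹ • ξ‖ ^ 2) * ‖μ⁻¹ • ξ‖ ^ (-δ)) := by
          have : ‖ξ‖ ^ (-δ) = μ ^ (-δ) * ‖μ⁻¹ • ξ‖ ^ (-δ) := by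
            rw [norm_smul, Real.norm_of_nonneg (by positivity),
              ← Real.mul_rpow hμ.le (by positivity), mul_inv_cancel_left₀ hμ.ne']
          rw [this]
          ring
  have hsecond : eLpNorm (fun x => regFun d a x * f x) 2 volume ≤
      ENNReal.ofReal (2 * s ^ (-(d / 2 : ℝ))) * J *
        (ENNReal.ofReal (K * μ ^ (-δ) * μ ^ (d / 2 : ℝ)) * Q * hSobNorm δ Φ) := by
    refine (eLpNorm_smul_le_mul_eLpNorm (p := 2) (q := ⊤) (r := 2) (f := f) (φ := regFun d a)
      (Lp.memLp _).1 (bddSymbol_regFun a).1.aestronglyMeasurable).trans ?_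
    exact mul_le_mul' (eLpNorm_regFun_le ha) hsup
  rw [eLpNorm_congr_ae hsplit]
  refine (eLpNorm_add_le hm₁ hm₂ (by norm_num)).trans ((add_le_add hfirst hsecond).trans ?_)
  rw [scaledNorm, mul_add]
  refine add_le_add ?_ ?_
  · refine le_mul_of_one_le_left' ?_
    rw [ENNReal.one_le_ofReal]
    have : 0 ≤ 2 * J.toReal * K * Q.toReal := by positivity
    linarith
  · rw [← ENNReal.ofReal_toReal hJt, ← ENNReal.ofReal_toReal hQt, ← mul_assoc, ← mul_assoc,
      ← mul_assoc, ← ENNReal.ofReal_mul (by positivity), ← ENNReal.ofReal_mul (by positivity),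
      ← ENNReal.ofReal_mul (by positivity), ← ENNReal.ofReal_mul (by positivity)]
    refine mul_le_mul_left (ENNReal.ofReal_le_ofReal ?_) _
    have : μ ^ ((d / 2 : ℝ) - δ) = μ ^ (-δ) * μ ^ (d / 2 : ℝ) := by
      rw [← Real.rpow_add hμ]
      ring_nf
    rw [this]
    have hpos : 0 ≤ s ^ (-(d / 2 : ℝ)) * (μ ^ (-δ) * μ ^ (d / 2 : ℝ)) := by positivity
    simp only [ENNReal.toReal_ofReal ENNReal.toReal_nonneg]
    nlinarith

section

open scoped LineDeriv Laplacian

open TemperedDistribution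

/-! ### Distributional derivatives of a weighted function -/

theorem toTemperedDistribution_mulOp {w : EuclideanSpace ℝ (Fin d) → ℂ} (hw : BddSymbol w)
    (hwt : w.HasTemperateGrowth) (g : L2 d) :
    Lp.toTemperedDistribution (mulOp w hw g) = smulLeftCLM ℂ w (Lp.toTemperedDistribution g) := by
  ext χ
  simp only [smulLeftCLM_apply_apply, Lp.toTemperedDistribution_apply]
  refine integral_congr_ae ?_
  filter_upwards [coeFn_mulOp w hw g] with x e
  rw [e, SchwartzMap.smulLeftCLM_apply_apply hwt, smul_eq_mul, smul_eq_mul, smul_eq_mul]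
  ring

theorem toTemperedDistribution_add (u v : L2 d) :
    Lp.toTemperedDistribution (u + v) =
      Lp.toTemperedDistribution u + Lp.toTemperedDistribution v :=
  map_add (Lp.toTemperedDistributionCLM ℂ (volume : Measure (EuclideanSpace ℝ (Fin d))) 2) u v

theorem toTemperedDistribution_smul (c : ℂ) (u : L2 d) :
    Lp.toTemperedDistribution (c • u) = c • Lp.toTemperedDistribution u :=
  map_smul (Lp.toTemperedDistributionCLM ℂ (volume : Measure (EuclideanSpace ℝ (Fin d))) 2) c u

theorem toTemperedDistribution_sum {ι : Type*} (s : Finset ι) (u : ι → L2 d) :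
    Lp.toTemperedDistribution (∑ i ∈ s, u i) = ∑ i ∈ s, Lp.toTemperedDistribution (u i) :=
  map_sum (Lp.toTemperedDistributionCLM ℂ (volume : Measure (EuclideanSpace ℝ (Fin d))) 2) u s

/-- The product rule for the product of a tempered distribution with a smooth function. -/
theorem lineDerivOp_smulLeftCLM {w w' : EuclideanSpace ℝ (Fin d) → ℂ} (hw : w.HasTemperateGrowth)
    (hw' : w'.HasTemperateGrowth) (v : EuclideanSpace ℝ (Fin d))
    (hd : ∀ x, HasLineDerivAt ℝ w (w' x) x v)
    (T : TemperedDistribution (EuclideanSpace ℝ (Fin d)) ℂ) :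
    ∂_{v} (smulLeftCLM ℂ w T) = smulLeftCLM ℂ w' T + smulLeftCLM ℂ w (∂_{v} T) := by
  ext χ
  rw [_root_.add_apply, lineDerivOp_apply_apply, smulLeftCLM_apply_apply,
    smulLeftCLM_apply_apply, smulLeftCLM_apply_apply, lineDerivOp_apply_apply, ← map_add]
  congr 1
  ext x
  have h1 : ∂_{v} (SchwartzMap.smulLeftCLM ℂ w χ) x = w' x * χ x + w x * ∂_{v} χ x := by
    rw [SchwartzMap.lineDerivOp_apply]
    have hχ : HasLineDerivAt ℝ χ (∂_{v} χ x) x v := by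
      rw [SchwartzMap.lineDerivOp_apply]
      exact (χ.differentiableAt.lineDifferentiableAt).hasLineDerivAt
    have e : (SchwartzMap.smulLeftCLM ℂ w χ : EuclideanSpace ℝ (Fin d) → ℂ) =
        fun x => w x * χ x := by
      ext y
      rw [SchwartzMap.smulLeftCLM_apply_apply hw, smul_eq_mul]
    rw [e]
    refine HasLineDerivAt.lineDeriv ?_
    have := HasDerivAt.fun_mul (hd x) hχ
    simpa only [HasLineDerivAt, zero_smul, add_zero] using! this
  simp only [_root_.add_apply, _root_.neg_apply, h1,
    SchwartzMap.smulLeftCLM_apply_apply hw, SchwartzMap.smulLeftCLM_apply_apply hw', smul_eq_mul]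
  ring

/-- The symbol `i ξ · v m(ξ)` of the derivative of `m(-i∇)` in the direction `v`. -/
def derivSymbol (v : EuclideanSpace ℝ (Fin d)) (m : EuclideanSpace ℝ (Fin d) → ℂ)
    (ξ : EuclideanSpace ℝ (Fin d)) : ℂ :=
  Complex.I * ((inner ℝ ξ v : ℝ) : ℂ) * m ξ

/-- Differentiation of `m(-i∇) Φ` multiplies the symbol by `i ξ · v`. -/
theorem lineDerivOp_fourierMul {m : EuclideanSpace ℝ (Fin d) → ℂ} (hm : BddSymbol m)
    (v : EuclideanSpace ℝ (Fin d))
    (hm' : BddSymbol (derivSymbol v m)) (Φ : L2 d) :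
    ∂_{v} (Lp.toTemperedDistribution (fourierMul m hm Φ)) =
      Lp.toTemperedDistribution (fourierMul _ hm' Φ) := by
  refine (FourierTransform.fourierEquiv ℂ
    (TemperedDistribution (EuclideanSpace ℝ (Fin d)) ℂ)).injective ?_
  simp only [FourierTransform.fourierEquiv_apply]
  rw [fourier_lineDerivOp_eq, Lp.fourier_toTemperedDistribution_eq,
    Lp.fourier_toTemperedDistribution_eq]
  ext χ
  have ht : (fun ξ : EuclideanSpace ℝ (Fin d) => ((inner ℝ ξ v : ℝ) : ℂ)).HasTemperateGrowth := by
    fun_prop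
  rw [_root_.smul_apply, smulLeftCLM_apply_apply, Lp.toTemperedDistribution_apply,
    Lp.toTemperedDistribution_apply, smul_eq_mul, ← integral_const_mul]
  refine integral_congr_ae ?_
  filter_upwards [coeFn_fourier_fourierMul m hm Φ, coeFn_fourier_fourierMul _ hm' Φ] with ξ e₁ e₂
  rw [e₁, e₂, SchwartzMap.smulLeftCLM_apply_apply ht, derivSymbol, inner_smul_left]
  simp only [smul_eq_mul, conj_trivial]
  push_cast
  ring

/-- If `Δ h = k` in the sense of distributions, then `ĥ = (1 + |2πξ|²/s²)⁻¹ (h - s⁻² k)^`. -/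
theorem fourier_eq_mulOp_of_laplacian_eq {h k : L2 d} (s : ℝ)
    (hb : BddSymbol fun ξ : EuclideanSpace ℝ (Fin d) =>
      (((1 + ‖(2 * Real.pi / s) • ξ‖ ^ 2)⁻¹ : ℝ) : ℂ))
    (hΔ : Δ (Lp.toTemperedDistribution h) = Lp.toTemperedDistribution k) :
    (𝓕 h : L2 d) = mulOp _ hb (𝓕 (h + (-(((s ^ 2)⁻¹ : ℝ) : ℂ)) • k)) := by
  have hbt : (fun ξ : EuclideanSpace ℝ (Fin d) =>
      (((1 + ‖(2 * Real.pi / s) • ξ‖ ^ 2)⁻¹ : ℝ) : ℂ)).HasTemperateGrowth := by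
    have h1 : (fun ξ : EuclideanSpace ℝ (Fin d) =>
        (1 + ‖ξ‖ ^ 2) ^ (-1 : ℝ)).HasTemperateGrowth := by fun_prop
    have h2 : (fun ξ : EuclideanSpace ℝ (Fin d) => (2 * Real.pi / s) • ξ).HasTemperateGrowth :=
      ((2 * Real.pi / s) • ContinuousLinearMap.id ℝ _).hasTemperateGrowth
    have h3 := Function.Complex.hasTemperateGrowth_ofReal.comp (h1.comp h2)
    refine (congrArg Function.HasTemperateGrowth (funext fun ξ => ?_)).mp h3
    simp only [Function.comp_apply, Real.rpow_neg_one]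
  have hnt : (fun ξ : EuclideanSpace ℝ (Fin d) => ((‖ξ‖ ^ 2 : ℝ) : ℂ)).HasTemperateGrowth := by
    fun_prop
  refine L2_ext_of_toTemperedDistribution_eq ?_
  have hk : 𝓕 (Lp.toTemperedDistribution k) = -(2 * Real.pi) ^ 2 •
      smulLeftCLM ℂ (fun ξ => ((‖ξ‖ ^ 2 : ℝ) : ℂ)) (𝓕 (Lp.toTemperedDistribution h)) := by
    rw [← hΔ, laplacian_eq_fourierMultiplierCLM, fourierMultiplierCLM_apply]
    ext χ
    simp
  rw [toTemperedDistribution_mulOp hb hbt, ← Lp.fourier_toTemperedDistribution_eq,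
    ← Lp.fourier_toTemperedDistribution_eq, toTemperedDistribution_add,
    toTemperedDistribution_smul, FourierTransform.fourier_add, FourierTransform.fourier_smul, hk]
  ext χ
  simp only [smulLeftCLM_apply_apply, _root_.add_apply,
    _root_.smul_apply, neg_smul, _root_.neg_apply]
  have hχ : χ = SchwartzMap.smulLeftCLM ℂ (fun ξ : EuclideanSpace ℝ (Fin d) =>
        (((1 + ‖(2 * Real.pi / s) • ξ‖ ^ 2)⁻¹ : ℝ) : ℂ)) χ +
      ((((s ^ 2)⁻¹ * (2 * Real.pi) ^ 2 : ℝ) : ℂ) •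
        SchwartzMap.smulLeftCLM ℂ (fun ξ : EuclideanSpace ℝ (Fin d) => ((‖ξ‖ ^ 2 : ℝ) : ℂ))
          (SchwartzMap.smulLeftCLM ℂ (fun ξ : EuclideanSpace ℝ (Fin d) =>
            (((1 + ‖(2 * Real.pi / s) • ξ‖ ^ 2)⁻¹ : ℝ) : ℂ)) χ)) := by
    ext ξ
    rw [_root_.add_apply, _root_.smul_apply, SchwartzMap.smulLeftCLM_apply_apply hbt,
      SchwartzMap.smulLeftCLM_apply_apply hnt, SchwartzMap.smulLeftCLM_apply_apply hbt]
    have hpos : (1 + ‖(2 * Real.pi / s) • ξ‖ ^ 2) ≠ 0 := by positivity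
    have hval : ‖(2 * Real.pi / s) • ξ‖ ^ 2 = (s ^ 2)⁻¹ * (2 * Real.pi) ^ 2 * ‖ξ‖ ^ 2 := by
      rw [norm_smul, mul_pow, Real.norm_eq_abs, sq_abs, div_pow]
      ring
    have hone : (1 + ‖(2 * Real.pi / s) • ξ‖ ^ 2)⁻¹ +
        (s ^ 2)⁻¹ * (2 * Real.pi) ^ 2 * (‖ξ‖ ^ 2 * (1 + ‖(2 * Real.pi / s) • ξ‖ ^ 2)⁻¹) = 1 := by
      rw [← mul_assoc, ← hval]
      field_simp
    have hone' := congrArg (fun r : ℝ => (r : ℂ)) hone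
    rw [Complex.ofReal_add, Complex.ofReal_mul, Complex.ofReal_mul (‖ξ‖ ^ 2),
      Complex.ofReal_one] at hone'
    simp only [smul_eq_mul]
    linear_combination (-χ ξ) * hone'
  conv_lhs => rw [hχ, map_add, map_smul]
  congr 1
  simp only [smul_eq_mul, Complex.real_smul]
  push_cast
  ring

/-! ### Derivatives of the regularizing weight -/

theorem hasTemperateGrowth_regFun (a : ℝ) : (regFun d a).HasTemperateGrowth := by
  have h1 : (fun y : ℝ => (1 + ‖y‖ ^ 2) ^ (-1 : ℝ)).HasTemperateGrowth := by fun_prop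
  have h2 : (fun x : EuclideanSpace ℝ (Fin d) => a * ‖x‖ ^ 2).HasTemperateGrowth := by fun_prop
  have h3 := Function.Complex.hasTemperateGrowth_ofReal.comp (h1.comp h2)
  have h4 : (fun x : EuclideanSpace ℝ (Fin d) =>
      1 - Complex.I * ((a * ‖x‖ ^ 2 : ℝ) : ℂ)).HasTemperateGrowth := by fun_prop
  refine (congrArg Function.HasTemperateGrowth (funext fun x => ?_)).mp (h4.mul h3)
  simp only [Pi.mul_apply, Function.comp_apply, Real.rpow_neg_one, regFun, Real.norm_eq_abs, sq_abs]
  set y := a * ‖x‖ ^ 2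
  have hy := one_add_I_mul_ofReal_ne_zero y
  have hy2 : (1 : ℂ) + (y : ℂ) ^ 2 ≠ 0 := by
    have : (1 + y ^ 2 : ℝ) ≠ 0 := by positivity
    exact_mod_cast this
  push_cast
  refine eq_inv_of_mul_eq_one_left ?_
  field_simp
  linear_combination (-(y : ℂ) ^ 2) * Complex.I_sq

/-- The derivative of `regFun d a` in the direction `v`. -/
def regFun₁ (a : ℝ) (v x : EuclideanSpace ℝ (Fin d)) : ℂ :=
  -2 * Complex.I * a * ((inner ℝ x v : ℝ) : ℂ) * regFun d a x ^ 2

/-- The second derivative of `regFun d a` in the direction of a unit vector `v`. -/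
def regFun₂ (a : ℝ) (v x : EuclideanSpace ℝ (Fin d)) : ℂ :=
  -2 * Complex.I * a * regFun d a x ^ 2 -
    8 * (a : ℂ) ^ 2 * ((inner ℝ x v : ℝ) : ℂ) ^ 2 * regFun d a x ^ 3

theorem hasTemperateGrowth_regFun₁ (a : ℝ) (v : EuclideanSpace ℝ (Fin d)) :
    (regFun₁ a v).HasTemperateGrowth := by
  have h := hasTemperateGrowth_regFun (d := d) a
  unfold regFun₁
  fun_prop

theorem hasTemperateGrowth_regFun₂ (a : ℝ) (v : EuclideanSpace ℝ (Fin d)) :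
    (regFun₂ a v).HasTemperateGrowth := by
  have h := hasTemperateGrowth_regFun (d := d) a
  unfold regFun₂
  fun_prop

theorem hasLineDerivAt_regFun (a : ℝ) (v x : EuclideanSpace ℝ (Fin d)) :
    HasLineDerivAt ℝ (regFun d a) (regFun₁ a v x) x v := by
  have h1 : HasDerivAt (fun t : ℝ => x + t • v) v 0 := by
    simpa using ((hasDerivAt_id (0 : ℝ)).smul_const v).const_add x
  have h2 := (((h1.norm_sq.const_mul a).ofReal_comp.const_mul Complex.I).const_add 1).fun_inv
    (one_add_I_mul_ofReal_ne_zero _)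
  rw [HasLineDerivAt]
  refine h2.congr_deriv ?_
  simp only [zero_smul, add_zero, regFun₁, regFun]
  have := one_add_I_mul_ofReal_ne_zero (a * ‖x‖ ^ 2)
  push_cast at this ⊢
  field_simp

theorem hasLineDerivAt_regFun₁ (a : ℝ) {v : EuclideanSpace ℝ (Fin d)} (hv : ‖v‖ = 1)
    (x : EuclideanSpace ℝ (Fin d)) :
    HasLineDerivAt ℝ (regFun₁ a v) (regFun₂ a v x) x v := by
  have h1 : HasDerivAt (fun t : ℝ => x + t • v) v 0 := by
    simpa using ((hasDerivAt_id (0 : ℝ)).smul_const v).const_add x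
  have h2 : HasDerivAt (fun t : ℝ => inner ℝ (x + t • v) v) 1 0 := by
    have := h1.inner ℝ (hasDerivAt_const (0 : ℝ) v)
    simpa [real_inner_self_eq_norm_sq, hv] using this
  have h3 : HasDerivAt (fun t : ℝ => regFun d a (x + t • v)) (regFun₁ a v x) 0 :=
    hasLineDerivAt_regFun a v x
  have h4 := (h2.ofReal_comp.const_mul (-2 * Complex.I * a)).fun_mul (h3.fun_pow 2)
  rw [HasLineDerivAt]
  refine h4.congr_deriv ?_
  simp only [zero_smul, add_zero, regFun₂, regFun₁]
  push_cast
  linear_combination (8 * (a : ℂ) ^ 2 * ((inner ℝ x v : ℝ) : ℂ) ^ 2 * regFun d a x ^ 3) *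
    Complex.I_sq

theorem norm_regFun₁_le (a : ℝ) {v : EuclideanSpace ℝ (Fin d)} (hv : ‖v‖ = 1)
    (x : EuclideanSpace ℝ (Fin d)) : ‖regFun₁ a v x‖ ≤ 2 * √|a| * ‖regFun d a x‖ := by
  have hin : |inner ℝ x v| ≤ ‖x‖ := by simpa [hv] using abs_real_inner_le_norm x v
  have hw := norm_regFun_le_one a x
  have hb := abs_mul_norm_regFun_le a x
  have hs : √|a| ^ 2 = |a| := Real.sq_sqrt (abs_nonneg a)
  set w := ‖regFun d a x‖ with hw'
  have hw0 : 0 ≤ w := norm_nonneg _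
  have h1 : √|a| * ‖x‖ * w ≤ 1 := by
    refine (sq_le_one_iff₀ (by positivity)).1 ?_
    calc (√|a| * ‖x‖ * w) ^ 2 = (|a| * ‖x‖ ^ 2 * w) * w := by rw [mul_pow, mul_pow, hs]; ring
      _ ≤ 1 * 1 := by gcongr
      _ = 1 := one_mul 1
  calc ‖regFun₁ a v x‖ = 2 * |a| * |inner ℝ x v| * w ^ 2 := by
        simp [regFun₁, hw']
    _ ≤ 2 * |a| * ‖x‖ * w ^ 2 := by gcongr
    _ = 2 * √|a| * w * (√|a| * ‖x‖ * w) := by linear_combination (-2 * ‖x‖ * w ^ 2) * hs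
    _ ≤ 2 * √|a| * w * 1 := by gcongr
    _ = _ := mul_one _

theorem norm_regFun₂_le (a : ℝ) {v : EuclideanSpace ℝ (Fin d)} (hv : ‖v‖ = 1)
    (x : EuclideanSpace ℝ (Fin d)) : ‖regFun₂ a v x‖ ≤ 10 * |a| * ‖regFun d a x‖ := by
  have hin : |inner ℝ x v| ≤ ‖x‖ := by simpa [hv] using abs_real_inner_le_norm x v
  have hw := norm_regFun_le_one a x
  have hb := abs_mul_norm_regFun_le a x
  set w := ‖regFun d a x‖ with hw'
  have hw0 : 0 ≤ w := norm_nonneg _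
  calc ‖regFun₂ a v x‖ ≤ 2 * |a| * w ^ 2 + 8 * |a| ^ 2 * |inner ℝ x v| ^ 2 * w ^ 3 := by
        refine (norm_sub_le _ _).trans (le_of_eq ?_)
        simp [hw']
    _ ≤ 2 * |a| * w ^ 2 + 8 * |a| ^ 2 * ‖x‖ ^ 2 * w ^ 3 := by gcongr
    _ = |a| * w * (2 * w + 8 * (|a| * ‖x‖ ^ 2 * w) * w) := by ring
    _ ≤ |a| * w * (2 * 1 + 8 * 1 * 1) := by gcongr
    _ = _ := by ring

theorem bddSymbol_regFun₁ (a : ℝ) {v : EuclideanSpace ℝ (Fin d)} (hv : ‖v‖ = 1) :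
    BddSymbol (regFun₁ a v) :=
  ⟨(hasTemperateGrowth_regFun₁ a v).1.continuous.measurable, 2 * √|a|, fun x =>
    (norm_regFun₁_le a hv x).trans
      (mul_le_of_le_one_right (by positivity) (norm_regFun_le_one a x))⟩

theorem bddSymbol_regFun₂ (a : ℝ) {v : EuclideanSpace ℝ (Fin d)} (hv : ‖v‖ = 1) :
    BddSymbol (regFun₂ a v) :=
  ⟨(hasTemperateGrowth_regFun₂ a v).1.continuous.measurable, 10 * |a|, fun x =>
    (norm_regFun₂_le a hv x).trans
      (mul_le_of_le_one_right (by positivity) (norm_regFun_le_one a x))⟩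

/-! ### The Fourier transform of a regularized function is integrable -/

theorem norm_derivSymbol_le {v : EuclideanSpace ℝ (Fin d)} (hv : ‖v‖ = 1)
    (m : EuclideanSpace ℝ (Fin d) → ℂ) (ξ : EuclideanSpace ℝ (Fin d)) :
    ‖derivSymbol v m ξ‖ ≤ ‖ξ‖ * ‖m ξ‖ := by
  have hin : |inner ℝ ξ v| ≤ ‖ξ‖ := by simpa [hv] using abs_real_inner_le_norm ξ v
  rw [derivSymbol, norm_mul, norm_mul, Complex.norm_I, one_mul, Complex.norm_real,
    Real.norm_eq_abs]
  gcongr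

theorem derivSymbol_eq_zero {v ξ : EuclideanSpace ℝ (Fin d)} {m : EuclideanSpace ℝ (Fin d) → ℂ}
    (h : m ξ = 0) : derivSymbol v m ξ = 0 := by
  rw [derivSymbol, h, mul_zero]

theorem BddSymbol.derivSymbol {v : EuclideanSpace ℝ (Fin d)} (hv : ‖v‖ = 1)
    {m : EuclideanSpace ℝ (Fin d) → ℂ} (hm : BddSymbol m) {R : ℝ} (hR : 0 ≤ R)
    (hsupp : ∀ ξ, R < ‖ξ‖ → m ξ = 0) : BddSymbol (TDHarmonic.derivSymbol v m) := by
  obtain ⟨hmeas, M, hM⟩ := hm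
  refine ⟨(by fun_prop : Measurable fun ξ : EuclideanSpace ℝ (Fin d) =>
    Complex.I * ((inner ℝ ξ v : ℝ) : ℂ)).mul hmeas, R * M, fun ξ => ?_⟩
  have hM0 : 0 ≤ M := (norm_nonneg _).trans (hM ξ)
  rcases le_or_gt ‖ξ‖ R with h | h
  · refine (norm_derivSymbol_le hv m ξ).trans ?_
    gcongr
    exact hM ξ
  · rw [derivSymbol_eq_zero (hsupp ξ h), norm_zero]
    positivity

/-- Leibniz rule for the second derivative of a weighted band-limited function. -/
theorem lineDerivOp_lineDerivOp_mulOp_regFun {v : EuclideanSpace ℝ (Fin d)} (hv : ‖v‖ = 1) (a : ℝ)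
    {m : EuclideanSpace ℝ (Fin d) → ℂ} (hm : BddSymbol m) (hm₁ : BddSymbol (derivSymbol v m))
    (hm₂ : BddSymbol (derivSymbol v (derivSymbol v m))) (Φ : L2 d) :
    ∂_{v} (∂_{v} (Lp.toTemperedDistribution
        (mulOp (regFun d a) (bddSymbol_regFun a) (fourierMul m hm Φ)))) =
      Lp.toTemperedDistribution
        (mulOp (regFun₂ a v) (bddSymbol_regFun₂ a hv) (fourierMul m hm Φ) +
          ((2 : ℂ) • mulOp (regFun₁ a v) (bddSymbol_regFun₁ a hv) (fourierMul _ hm₁ Φ) +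
            mulOp (regFun d a) (bddSymbol_regFun a) (fourierMul _ hm₂ Φ))) := by
  have t0 := hasTemperateGrowth_regFun (d := d) a
  have t1 := hasTemperateGrowth_regFun₁ a v
  have t2 := hasTemperateGrowth_regFun₂ a v
  have e₁ := lineDerivOp_fourierMul hm v hm₁ Φ
  have e₂ := lineDerivOp_fourierMul hm₁ v hm₂ Φ
  rw [toTemperedDistribution_add, toTemperedDistribution_add, toTemperedDistribution_smul,
    toTemperedDistribution_mulOp _ t0, toTemperedDistribution_mulOp _ t0,
    toTemperedDistribution_mulOp _ t1, toTemperedDistribution_mulOp _ t2,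
    lineDerivOp_smulLeftCLM t0 t1 v (hasLineDerivAt_regFun a v), e₁, LineDeriv.lineDerivOp_add,
    lineDerivOp_smulLeftCLM t1 t2 v (hasLineDerivAt_regFun₁ a hv), e₁,
    lineDerivOp_smulLeftCLM t0 t1 v (hasLineDerivAt_regFun a v), e₂, two_smul]
  abel

theorem eLpNorm_mulOp_mono {w w' : EuclideanSpace ℝ (Fin d) → ℂ} (hw : BddSymbol w)
    (hw' : BddSymbol w') {A : ℝ} (h : ∀ x, ‖w x‖ ≤ A * ‖w' x‖) (g : L2 d) :
    eLpNorm (mulOp w hw g) 2 volume ≤ ENNReal.ofReal A * eLpNorm (mulOp w' hw' g) 2 volume := by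
  refine eLpNorm_le_mul_eLpNorm_of_ae_le_mul ?_ 2
  filter_upwards [coeFn_mulOp w hw g, coeFn_mulOp w' hw' g] with x e₁ e₂
  rw [e₁, e₂, norm_mul, norm_mul, ← mul_assoc]
  gcongr
  exact h x

theorem eLpNorm_fourierMul_le_hSobNorm {δ B : ℝ} {m : EuclideanSpace ℝ (Fin d) → ℂ}
    (hm : BddSymbol m) (h : ∀ ξ, ‖m ξ‖ ≤ B * ‖ξ‖ ^ δ) (Φ : L2 d) :
    eLpNorm (fourierMul m hm Φ) 2 volume ≤ ENNReal.ofReal B * hSobNorm δ Φ := by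
  rw [← eLpNorm_fourier]
  refine eLpNorm_le_mul_eLpNorm_of_ae_le_mul ?_ 2
  filter_upwards [coeFn_fourier_fourierMul m hm Φ] with ξ e
  have h2π : (0 : ℝ) ≤ 2 * Real.pi := by positivity
  have := h ((2 * Real.pi) • ξ)
  rw [norm_smul, Real.norm_of_nonneg h2π] at this
  rw [e, norm_mul, norm_mul, Complex.norm_real, Real.norm_of_nonneg (by positivity), ← mul_assoc]
  gcongr

/-- As `μ ≲ s`, the term `s^{-δ} ‖Φ‖_{Ḣ^δ}` is controlled by the second term of `scaledNorm`. -/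
theorem ofReal_rpow_mul_hSobNorm_le {δ s μ κ : ℝ} (h₁ : (d : ℝ) / 2 < δ) (hs : 0 < s) (hμ : 0 < μ)
    (hκ : 0 < κ) (hμs : μ ≤ κ * s) (Φ : L2 d) :
    ENNReal.ofReal (s ^ (-δ)) * hSobNorm δ Φ ≤
      ENNReal.ofReal (κ ^ (δ - d / 2 : ℝ)) * scaledNorm δ s μ Φ := by
  rw [scaledNorm, mul_add, ← mul_assoc, ← mul_assoc,
    ← ENNReal.ofReal_mul (by positivity), ← ENNReal.ofReal_mul (by positivity)]
  refine le_add_left (mul_le_mul_left (ENNReal.ofReal_le_ofReal ?_) _)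
  have h2 : s ^ ((d / 2 : ℝ) - δ) ≤ (μ / κ) ^ ((d / 2 : ℝ) - δ) :=
    Real.rpow_le_rpow_of_nonpos (by positivity) (by rwa [div_le_iff₀' hκ]) (by linarith)
  calc s ^ (-δ) = s ^ (-(d / 2 : ℝ)) * s ^ ((d / 2 : ℝ) - δ) := by
        rw [← Real.rpow_add hs]
        ring_nf
    _ ≤ s ^ (-(d / 2 : ℝ)) * (μ / κ) ^ ((d / 2 : ℝ) - δ) := by gcongr
    _ = _ := by
        rw [Real.div_rpow hμ.le hκ.le, ← neg_sub ((d : ℝ) / 2) δ, Real.rpow_neg hκ.le]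
        ring

/-- The weighted function `h = (1 + i a |x|²)⁻¹ g` satisfies `‖h‖₂ + s⁻² ‖Δ h‖₂ ≲ scaledNorm`, where
`s = |a|^{1/2}`, if the frequencies of `g` are at most of size `s`. Hence `ĥ` is integrable, as
`(1 + |ξ|²/s²)⁻¹` is square integrable for `d < 4`. In `Δ h`, the terms with `Δ w` are controlled by
`w g` itself, those with `∇ w · ∇ g` by a pointwise bound for `∇ g`, and `w Δ g` by Plancherel. -/
theorem exists_eLpNorm_one_fourier_le (hd1 : 1 ≤ d) (hd : d < 4) {δ : ℝ} (h₁ : (d : ℝ) / 2 < δ)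
    (h₂ : δ ≤ 2) (h₃ : δ < 1 + (d : ℝ) / 2) {K L κ : ℝ} (hK : 0 ≤ K) (hL : 0 < L) (hκ : 0 < κ) :
    ∃ C : ℝ, 0 ≤ C ∧ ∀ (a μ : ℝ), a ≠ 0 → 0 < μ → μ ≤ κ * √|a| →
      ∀ (m : EuclideanSpace ℝ (Fin d) → ℂ) (hm : BddSymbol m),
      (∀ ξ, ‖m ξ - 1‖ ≤ K * min 1 (‖μ⁻¹ • ξ‖ ^ 2)) → (∀ ξ, ‖m ξ‖ ≤ 1) →
      (∀ ξ, L * √|a| < ‖ξ‖ → m ξ = 0) → ∀ Φ : L2 d,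
      eLpNorm (𝓕 (mulOp (regFun d a) (bddSymbol_regFun a) (fourierMul m hm Φ)) : L2 d) 1 volume ≤
        ENNReal.ofReal (C * √|a| ^ (d / 2 : ℝ)) * scaledNorm δ (√|a|) μ Φ := by
  obtain ⟨C₀, hC₀, hC⟩ := exists_eLpNorm_mulOp_regFun_le hd1 hd h₁ h₂ hK
  set J := eLpNorm (fun x : EuclideanSpace ℝ (Fin d) => (1 + ‖x‖ ^ 2)⁻¹) 2 volume with hJ
  set P := eLpNorm (fun x : EuclideanSpace ℝ (Fin d) => if ‖x‖ ≤ 1 then ‖x‖ ^ (1 - δ) else 0) 2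
    volume with hP
  have hJt : J ≠ ⊤ := (memLp_inv_one_add_norm_sq hd).2.ne
  have hPt : P ≠ ⊤ := (memLp_indicator_rpow hd1 h₃).2.ne
  set C₁ : ℝ := 8 * J.toReal * P.toReal * (L ^ (1 - δ) * L ^ (d / 2 : ℝ)) + L ^ (2 - δ) with hC₁
  have hC₁0 : 0 ≤ C₁ := by positivity
  set C₂ : ℝ := 10 * C₀ + C₁ * κ ^ (δ - d / 2 : ℝ) with hC₂
  have hC₂0 : 0 ≤ C₂ := by positivity
  refine ⟨J.toReal * (C₀ + d * C₂), by positivity, fun a μ ha hμ hμs m hm hmK hm1 hsupp Φ => ?_⟩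
  have hs : 0 < √|a| := Real.sqrt_pos.2 (abs_pos.2 ha)
  have hsa : √|a| ^ 2 = |a| := Real.sq_sqrt (abs_nonneg a)
  have hCΦ := hC a μ ha hμ m hm hmK Φ
  have hHS := ofReal_rpow_mul_hSobNorm_le h₁ hs hμ hκ hμs Φ
  set s := √|a| with hs'
  set S := scaledNorm δ s μ Φ with hS
  set g := fourierMul m hm Φ with hg
  set h := mulOp (regFun d a) (bddSymbol_regFun a) g with hh
  set b := EuclideanSpace.basisFun (Fin d) ℝ with hb
  have hbn : ∀ i, ‖b i‖ = 1 := fun i => b.norm_eq_one i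
  have hm₁ : ∀ i, BddSymbol (derivSymbol (b i) m) := fun i =>
    hm.derivSymbol (hbn i) (by positivity) hsupp
  have hm₂ : ∀ i, BddSymbol (derivSymbol (b i) (derivSymbol (b i) m)) := fun i =>
    (hm₁ i).derivSymbol (hbn i) (by positivity : 0 ≤ L * s) fun ξ hξ =>
      derivSymbol_eq_zero (hsupp ξ hξ)
  set k : Fin d → L2 d := fun i => mulOp (regFun₂ a (b i)) (bddSymbol_regFun₂ a (hbn i)) g +
    ((2 : ℂ) • mulOp (regFun₁ a (b i)) (bddSymbol_regFun₁ a (hbn i)) (fourierMul _ (hm₁ i) Φ) +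
      mulOp (regFun d a) (bddSymbol_regFun a) (fourierMul _ (hm₂ i) Φ)) with hk
  have hΔ : Δ (Lp.toTemperedDistribution h) = Lp.toTemperedDistribution (∑ i, k i) := by
    rw [laplacian_eq_sum b, toTemperedDistribution_sum]
    exact Finset.sum_congr rfl fun i _ =>
      lineDerivOp_lineDerivOp_mulOp_regFun (hbn i) a hm (hm₁ i) (hm₂ i) Φ
  -- the three contributions to each second derivative
  have hA : ∀ i, ‖mulOp (regFun₂ a (b i)) (bddSymbol_regFun₂ a (hbn i)) g‖ₑ ≤
      ENNReal.ofReal (s ^ 2) * (ENNReal.ofReal (10 * C₀) * S) := fun i => by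
    rw [Lp.enorm_def]
    refine (eLpNorm_mulOp_mono _ (bddSymbol_regFun a) (norm_regFun₂_le a (hbn i)) g).trans ?_
    refine (mul_le_mul_right hCΦ _).trans (le_of_eq ?_)
    rw [← mul_assoc, ← mul_assoc, ← ENNReal.ofReal_mul (by positivity),
      ← ENNReal.ofReal_mul (by positivity), hsa]
    ring_nf
  have hpow : (L * s) ^ (1 - δ) * (L * s) ^ (d / 2 : ℝ) * s ^ (-(d / 2 : ℝ)) * s =
      s ^ 2 * (L ^ (1 - δ) * L ^ (d / 2 : ℝ)) * s ^ (-δ) := by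
    rw [Real.mul_rpow hL.le hs.le, Real.mul_rpow hL.le hs.le]
    have e1 : s ^ (d / 2 : ℝ) * s ^ (-(d / 2 : ℝ)) = 1 := by rw [← Real.rpow_add hs]; simp
    have e2 : s ^ (1 - δ) * s = s ^ 2 * s ^ (-δ) := by
      rw [← Real.rpow_natCast s 2, ← Real.rpow_add hs, ← Real.rpow_add_one hs.ne']
      congr 1
      push_cast
      ring
    linear_combination (L ^ (1 - δ) * L ^ (d / 2 : ℝ) * (s ^ (1 - δ) * s)) * e1 +
      (L ^ (1 - δ) * L ^ (d / 2 : ℝ)) * e2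
  have hB : ∀ i, ‖mulOp (regFun₁ a (b i)) (bddSymbol_regFun₁ a (hbn i))
      (fourierMul _ (hm₁ i) Φ)‖ₑ ≤ ENNReal.ofReal (s ^ 2) *
        (ENNReal.ofReal (4 * J.toReal * P.toReal * (L ^ (1 - δ) * L ^ (d / 2 : ℝ))) *
          (ENNReal.ofReal (s ^ (-δ)) * hSobNorm δ Φ)) := fun i => by
    have hw : eLpNorm (regFun₁ a (b i)) 2 volume ≤
        ENNReal.ofReal (2 * s) * (ENNReal.ofReal (2 * s ^ (-(d / 2 : ℝ))) * J) :=
      (eLpNorm_le_mul_eLpNorm_of_ae_le_mul (ae_of_all _ (norm_regFun₁_le a (hbn i))) 2).trans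
        (mul_le_mul_right (eLpNorm_regFun_le ha) _)
    have hsup : eLpNorm (fourierMul _ (hm₁ i) Φ) ⊤ volume ≤
        ENNReal.ofReal ((L * s) ^ (1 - δ) * (L * s) ^ (d / 2 : ℝ)) * P * hSobNorm δ Φ := by
      refine eLpNorm_top_fourierMul_le_scaled hd1 (hm₁ i)
        (Measurable.ite (measurableSet_le measurable_norm measurable_const) (by fun_prop)
          measurable_const) (by positivity) (by positivity) (fun ξ hξ => ?_) Φ
      have hξ' : 0 < ‖ξ‖ := norm_pos_iff.2 hξ
      have hLs : 0 < L * s := by positivity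
      have hn : ‖(L * s)⁻¹ • ξ‖ = (L * s)⁻¹ * ‖ξ‖ := by
        rw [norm_smul, Real.norm_of_nonneg (by positivity)]
      rw [hn]
      rcases le_or_gt ‖ξ‖ (L * s) with hle | hlt
      · rw [if_pos (by rwa [inv_mul_le_iff₀ hLs, mul_one]),
          ← Real.mul_rpow hLs.le (by positivity), mul_inv_cancel_left₀ hLs.ne',
          sub_eq_add_neg, Real.rpow_add hξ', Real.rpow_one]
        gcongr
        exact (norm_derivSymbol_le (hbn i) m ξ).trans
          (mul_le_of_le_one_right hξ'.le (hm1 ξ))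
      · rw [derivSymbol_eq_zero (hsupp ξ hlt), norm_zero, zero_mul]
        positivity
    rw [Lp.enorm_def, eLpNorm_congr_ae (coeFn_mulOp _ _ _)]
    refine (eLpNorm_smul_le_mul_eLpNorm (p := 2) (q := ⊤) (r := 2)
      (f := fourierMul _ (hm₁ i) Φ) (φ := regFun₁ a (b i))
      (Lp.memLp _).1 (bddSymbol_regFun₁ a (hbn i)).1.aestronglyMeasurable).trans ?_
    refine (mul_le_mul' hw hsup).trans (le_of_eq ?_)
    rw [← ENNReal.ofReal_toReal hJt, ← ENNReal.ofReal_toReal hPt]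
    simp only [← mul_assoc, ENNReal.toReal_ofReal ENNReal.toReal_nonneg]
    rw [← ENNReal.ofReal_mul (by positivity), ← ENNReal.ofReal_mul (by positivity),
      ← ENNReal.ofReal_mul (by positivity), ← ENNReal.ofReal_mul (by positivity),
      ← ENNReal.ofReal_mul (by positivity), ← ENNReal.ofReal_mul (by positivity)]
    congr 2
    linear_combination (4 * J.toReal * P.toReal) * hpow
  have hD : ∀ i, ‖mulOp (regFun d a) (bddSymbol_regFun a) (fourierMul _ (hm₂ i) Φ)‖ₑ ≤
      ENNReal.ofReal (s ^ 2) * (ENNReal.ofReal (L ^ (2 - δ)) *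
          (ENNReal.ofReal (s ^ (-δ)) * hSobNorm δ Φ)) := fun i => by
    have h1 : ‖mulOp (regFun d a) (bddSymbol_regFun a) (fourierMul _ (hm₂ i) Φ)‖ₑ ≤
        eLpNorm (fourierMul _ (hm₂ i) Φ) 2 volume := by
      rw [Lp.enorm_def]
      refine eLpNorm_mono_ae ?_
      filter_upwards [coeFn_mulOp (regFun d a) (bddSymbol_regFun a) (fourierMul _ (hm₂ i) Φ)]
        with x e
      rw [e, norm_mul]
      exact mul_le_of_le_one_left (norm_nonneg _) (norm_regFun_le_one a x)
    refine h1.trans ((eLpNorm_fourierMul_le_hSobNorm (δ := δ) (B := (L * s) ^ (2 - δ)) (hm₂ i)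
      (fun ξ => ?_) Φ).trans (le_of_eq ?_))
    · rcases le_or_gt ‖ξ‖ (L * s) with hle | hlt
      · refine (norm_derivSymbol_le (hbn i) _ ξ).trans ?_
        have hle' : ‖ξ‖ * ‖derivSymbol (b i) m ξ‖ ≤ ‖ξ‖ ^ 2 := by
          rw [sq]
          gcongr
          exact (norm_derivSymbol_le (hbn i) m ξ).trans
            (mul_le_of_le_one_right (norm_nonneg ξ) (hm1 ξ))
        refine hle'.trans ?_
        rcases eq_or_lt_of_le (norm_nonneg ξ) with h0 | h0
        · rw [← h0]
          rw [zero_pow two_ne_zero]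
          positivity
        · calc ‖ξ‖ ^ 2 = ‖ξ‖ ^ (2 - δ) * ‖ξ‖ ^ δ := by
                rw [← Real.rpow_natCast, ← Real.rpow_add h0]
                norm_num
            _ ≤ (L * s) ^ (2 - δ) * ‖ξ‖ ^ δ := by
                gcongr
      · rw [derivSymbol_eq_zero (derivSymbol_eq_zero (hsupp ξ hlt)), norm_zero]
        positivity
    · rw [← mul_assoc, ← mul_assoc, ← ENNReal.ofReal_mul (by positivity),
        ← ENNReal.ofReal_mul (by positivity)]
      congr 2
      rw [Real.mul_rpow hL.le hs.le, sub_eq_add_neg 2 δ, Real.rpow_add hs]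
      norm_num
      ring
  have hki : ∀ i, ‖k i‖ₑ ≤ ENNReal.ofReal (s ^ 2 * C₂) * S := fun i => by
    have h2 : ‖(2 : ℂ)‖ₑ = ENNReal.ofReal 2 := by
      rw [← ofReal_norm]
      simp
    calc ‖k i‖ₑ ≤ ENNReal.ofReal (s ^ 2) * (ENNReal.ofReal (10 * C₀) * S) +
          (ENNReal.ofReal 2 * (ENNReal.ofReal (s ^ 2) *
            (ENNReal.ofReal (4 * J.toReal * P.toReal * (L ^ (1 - δ) * L ^ (d / 2 : ℝ))) *
              (ENNReal.ofReal (s ^ (-δ)) * hSobNorm δ Φ))) +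
          ENNReal.ofReal (s ^ 2) * (ENNReal.ofReal (L ^ (2 - δ)) *
            (ENNReal.ofReal (s ^ (-δ)) * hSobNorm δ Φ))) := by
          refine (enorm_add_le _ _).trans (add_le_add (hA i) ((enorm_add_le _ _).trans
            (add_le_add ?_ (hD i))))
          rw [enorm_smul, h2]
          exact mul_le_mul_right (hB i) _
      _ = ENNReal.ofReal (s ^ 2) * (ENNReal.ofReal (10 * C₀) * S +
            ENNReal.ofReal C₁ * (ENNReal.ofReal (s ^ (-δ)) * hSobNorm δ Φ)) := by
          rw [hC₁, ENNReal.ofReal_add (by positivity) (by positivity),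
            show 8 * J.toReal * P.toReal * (L ^ (1 - δ) * L ^ (d / 2 : ℝ)) =
              2 * (4 * J.toReal * P.toReal * (L ^ (1 - δ) * L ^ (d / 2 : ℝ))) by ring,
            ENNReal.ofReal_mul (by norm_num : (0 : ℝ) ≤ 2)]
          ring
      _ ≤ ENNReal.ofReal (s ^ 2) * (ENNReal.ofReal (10 * C₀) * S +
            ENNReal.ofReal C₁ * (ENNReal.ofReal (κ ^ (δ - d / 2 : ℝ)) * S)) := by gcongr
      _ = ENNReal.ofReal (s ^ 2 * C₂) * S := by
          rw [ENNReal.ofReal_mul (p := s ^ 2) (by positivity), hC₂,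
            ENNReal.ofReal_add (p := 10 * C₀) (by positivity) (by positivity),
            ENNReal.ofReal_mul (p := C₁) hC₁0]
          ring
  set e := h + (-(((s ^ 2)⁻¹ : ℝ) : ℂ)) • ∑ i, k i with he
  have hen : ‖e‖ₑ ≤ ENNReal.ofReal (C₀ + d * C₂) * S := by
    have hn : ‖(-(((s ^ 2)⁻¹ : ℝ) : ℂ))‖ₑ = ENNReal.ofReal ((s ^ 2)⁻¹) := by
      rw [enorm_neg, ← ofReal_norm, Complex.norm_real, Real.norm_of_nonneg (by positivity)]
    calc ‖e‖ₑ ≤ ENNReal.ofReal C₀ * S +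
          ENNReal.ofReal ((s ^ 2)⁻¹) * ∑ _i : Fin d, ENNReal.ofReal (s ^ 2 * C₂) * S := by
          refine (enorm_add_le _ _).trans (add_le_add ?_ ?_)
          · rw [Lp.enorm_def]
            exact hCΦ
          · rw [enorm_smul, hn]
            gcongr
            exact (enorm_sum_le _ _).trans (Finset.sum_le_sum fun i _ => hki i)
      _ = ENNReal.ofReal (C₀ + d * C₂) * S := by
          rw [Finset.sum_const, Finset.card_univ, Fintype.card_fin, nsmul_eq_mul,
            ENNReal.ofReal_add hC₀ (by positivity), add_mul, ENNReal.ofReal_mul (by positivity),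
            ENNReal.ofReal_mul (by positivity), ENNReal.ofReal_natCast]
          have : ENNReal.ofReal ((s ^ 2)⁻¹) * ENNReal.ofReal (s ^ 2) = 1 := by
            rw [← ENNReal.ofReal_mul (by positivity), inv_mul_cancel₀ (by positivity),
              ENNReal.ofReal_one]
          congr 1
          calc _ = ENNReal.ofReal ((s ^ 2)⁻¹) * ENNReal.ofReal (s ^ 2) *
                  (d * ENNReal.ofReal C₂ * S) := by ring
            _ = _ := by rw [this, one_mul]
  have hbs : BddSymbol fun ξ : EuclideanSpace ℝ (Fin d) =>
      (((1 + ‖(2 * Real.pi / s) • ξ‖ ^ 2)⁻¹ : ℝ) : ℂ) := by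
    refine ⟨by fun_prop, 1, fun ξ => ?_⟩
    rw [Complex.norm_real, Real.norm_of_nonneg (by positivity)]
    exact inv_le_one_of_one_le₀ (by nlinarith [sq_nonneg ‖(2 * Real.pi / s) • ξ‖])
  have hbn2 : eLpNorm (fun ξ : EuclideanSpace ℝ (Fin d) =>
      (((1 + ‖(2 * Real.pi / s) • ξ‖ ^ 2)⁻¹ : ℝ) : ℂ)) 2 volume ≤
        ENNReal.ofReal (s ^ (d / 2 : ℝ)) * J := by
    have e1 : eLpNorm (fun ξ : EuclideanSpace ℝ (Fin d) =>
        (((1 + ‖(2 * Real.pi / s) • ξ‖ ^ 2)⁻¹ : ℝ) : ℂ)) 2 volume =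
        eLpNorm (fun ξ : EuclideanSpace ℝ (Fin d) =>
          (1 + ‖(2 * Real.pi / s) • ξ‖ ^ 2)⁻¹) 2 volume :=
      eLpNorm_congr_norm_ae (ae_of_all _ fun ξ => by rw [Complex.norm_real])
    have hpi : 0 < 2 * Real.pi / s := by positivity
    rw [e1, eLpNorm_comp_const_smul (f := fun ξ : EuclideanSpace ℝ (Fin d) => (1 + ‖ξ‖ ^ 2)⁻¹)
      (by fun_prop : Measurable _).aestronglyMeasurable hpi.ne', abs_of_pos hpi]
    refine mul_le_mul_left (ENNReal.ofReal_le_ofReal ?_) _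
    rw [Real.rpow_neg hpi.le, ← Real.inv_rpow hpi.le]
    refine Real.rpow_le_rpow (by positivity) ?_ (by positivity)
    rw [inv_div, div_le_iff₀ (by positivity)]
    nlinarith [Real.pi_gt_three]
  rw [fourier_eq_mulOp_of_laplacian_eq s hbs hΔ, eLpNorm_congr_ae (coeFn_mulOp _ _ _)]
  refine (eLpNorm_smul_le_mul_eLpNorm (p := 2) (q := 2) (r := 1) (f := (𝓕 e : L2 d))
    (φ := fun ξ : EuclideanSpace ℝ (Fin d) => (((1 + ‖(2 * Real.pi / s) • ξ‖ ^ 2)⁻¹ : ℝ) : ℂ))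
    (Lp.memLp _).1 hbs.1.aestronglyMeasurable).trans ?_
  rw [eLpNorm_fourier, ← Lp.enorm_def]
  refine (mul_le_mul' hbn2 hen).trans (le_of_eq ?_)
  rw [← ENNReal.ofReal_toReal hJt, ← mul_assoc, ← ENNReal.ofReal_mul (by positivity),
    ← ENNReal.ofReal_mul (by positivity), ENNReal.toReal_ofReal ENNReal.toReal_nonneg]
  congr 2
  ring

end

/-! ### Interpolation -/

theorem eLpNorm_le_rpow_mul_rpow {α F : Type*} [MeasurableSpace α] {μ : Measure α}
    [NormedAddCommGroup F] {f : α → F} (hf : AEStronglyMeasurable f μ)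
    {r : ℝ≥0∞} (hr : 2 ≤ r) :
    eLpNorm f r μ ≤
      eLpNorm f ⊤ μ ^ (1 - 2 * (r⁻¹).toReal) * eLpNorm f 2 μ ^ (2 * (r⁻¹).toReal) := by
  rcases eq_or_ne r ⊤ with rfl | hrt
  · simp
  have hr0 : r ≠ 0 := (lt_of_lt_of_le (by norm_num) hr).ne'
  by_cases hf0 : f =ᵐ[μ] 0
  · rw [eLpNorm_congr_ae hf0, eLpNorm_zero]
    exact bot_le
  have hz : ∫⁻ x, ‖f x‖ₑ ^ (2 : ℝ) ∂μ ≠ 0 := fun h => by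
    refine hf0 ((eLpNorm_eq_zero_iff hf (by norm_num : (2 : ℝ≥0∞) ≠ 0)).1 ?_)
    rw [eLpNorm_eq_lintegral_rpow_enorm_toReal (by norm_num) (by norm_num), ENNReal.toReal_ofNat, h]
    simp
  set p := r.toReal with hp
  have hp2 : 2 ≤ p := by
    have := ENNReal.toReal_mono hrt hr
    simpa using this
  have hp0 : 0 < p := by linarith
  rw [ENNReal.toReal_inv, ← hp]
  have hbd : ∫⁻ x, ‖f x‖ₑ ^ p ∂μ ≤ eLpNorm f ⊤ μ ^ (p - 2) * ∫⁻ x, ‖f x‖ₑ ^ (2 : ℝ) ∂μ := by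
    by_cases htop : eLpNorm f ⊤ μ ^ (p - 2) = ⊤
    · rw [htop, ENNReal.top_mul hz]
      exact le_top
    rw [← lintegral_const_mul' _ _ htop]
    refine lintegral_mono_ae ?_
    filter_upwards [ae_le_eLpNormEssSup (f := f) (μ := μ)] with x hx
    calc ‖f x‖ₑ ^ p = ‖f x‖ₑ ^ (p - 2) * ‖f x‖ₑ ^ (2 : ℝ) := by
          rw [← ENNReal.rpow_add_of_nonneg _ _ (by linarith) (by norm_num)]
          ring_nf
      _ ≤ _ := by
          rw [eLpNorm_exponent_top]
          gcongr
  rw [eLpNorm_eq_lintegral_rpow_enorm_toReal hr0 hrt,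
    eLpNorm_eq_lintegral_rpow_enorm_toReal (by norm_num : (2 : ℝ≥0∞) ≠ 0) (by norm_num), ← hp,
    ENNReal.toReal_ofNat]
  calc (∫⁻ x, ‖f x‖ₑ ^ p ∂μ) ^ (1 / p)
      ≤ (eLpNorm f ⊤ μ ^ (p - 2) * ∫⁻ x, ‖f x‖ₑ ^ (2 : ℝ) ∂μ) ^ (1 / p) := by gcongr
    _ = _ := by
        rw [ENNReal.mul_rpow_of_nonneg _ _ (by positivity), ← ENNReal.rpow_mul, ← ENNReal.rpow_mul]
        congr 2
        · field_simp
        · field_simp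

theorem eLpNorm_expLap_two (b : ℝ) (h : L2 d) :
    eLpNorm (expLap b h) 2 volume = eLpNorm h 2 volume := by
  rw [← eLpNorm_fourier, ← eLpNorm_fourier h]
  refine eLpNorm_congr_norm_ae ?_
  filter_upwards [coeFn_fourier_fourierMul _ (bddSymbol_schrodinger b) h] with ξ hξ
  rw [expLap, hξ, norm_mul, Complex.norm_exp_ofReal_mul_I, one_mul]

theorem eLpNorm_top_expLap_le (b : ℝ) (h : L2 d) :
    eLpNorm (expLap b h) ⊤ volume ≤ eLpNorm (𝓕 h : L2 d) 1 volume := by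
  refine (eLpNorm_top_fourierInv_le _).trans (le_of_eq ?_)
  refine eLpNorm_congr_norm_ae ?_
  filter_upwards [coeFn_mulOp (fun ξ => _) ((bddSymbol_schrodinger b).comp_smul (2 * Real.pi))
    (𝓕 h : L2 d)] with ξ hξ
  rw [hξ, norm_mul, Complex.norm_exp_ofReal_mul_I, one_mul]

/-- The estimates in `L²` and, after applying `e^{ibΔ}` with arbitrary `b`, in `L^r` for the
function `h = (1 + i a |x|²)⁻¹ m(-i∇) Φ`. The `L^∞` norm is at most `‖ĥ‖₁`, independently of `b`. -/
theorem exists_eLpNorm_expLap_mulOp_regFun_le (hd1 : 1 ≤ d) (hd : d < 4) {δ K L κ : ℝ}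
    (h₁ : (d : ℝ) / 2 < δ) (h₂ : δ ≤ 2) (h₃ : δ < 1 + (d : ℝ) / 2) (hK : 0 ≤ K) (hL : 0 < L)
    (hκ : 0 < κ) :
    ∃ C : ℝ, 0 < C ∧ ∀ a μ : ℝ, a ≠ 0 → 0 < μ → μ ≤ κ * √|a| →
      ∀ (m : EuclideanSpace ℝ (Fin d) → ℂ) (hm : BddSymbol m),
        (∀ ξ, ‖m ξ - 1‖ ≤ K * min 1 (‖μ⁻¹ • ξ‖ ^ 2)) → (∀ ξ, ‖m ξ‖ ≤ 1) →
        (∀ ξ, L * √|a| < ‖ξ‖ → m ξ = 0) → ∀ Φ : L2 d,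
        eLpNorm (mulOp (regFun d a) (bddSymbol_regFun a) (fourierMul m hm Φ)) 2 volume ≤
          ENNReal.ofReal C * scaledNorm δ √|a| μ Φ ∧
        ∀ (b : ℝ) (r : ℝ≥0∞), 2 ≤ r →
          eLpNorm (expLap b (mulOp (regFun d a) (bddSymbol_regFun a) (fourierMul m hm Φ)))
              r volume ≤
            ENNReal.ofReal (C * √|a| ^ ((d : ℝ) * (1 / 2 - (r⁻¹).toReal))) *
              scaledNorm δ √|a| μ Φ := by
  obtain ⟨C₁, hC₁, H₁⟩ := exists_eLpNorm_mulOp_regFun_le hd1 hd h₁ h₂ hK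
  obtain ⟨C₂, hC₂, H₂⟩ := exists_eLpNorm_one_fourier_le hd1 hd h₁ h₂ h₃ hK hL hκ
  refine ⟨C₁ + C₂ + 1, by positivity, fun a μ ha hμ hμa m hm hm1 hmb hms Φ => ?_⟩
  set C := C₁ + C₂ + 1 with hC
  have hC0 : 0 < C := by positivity
  have hs : 0 < √|a| := Real.sqrt_pos.2 (abs_pos.2 ha)
  set h := mulOp (regFun d a) (bddSymbol_regFun a) (fourierMul m hm Φ) with hh
  set S := scaledNorm δ √|a| μ Φ with hS
  have e₁ : eLpNorm h 2 volume ≤ ENNReal.ofReal C * S := by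
    refine (H₁ a μ ha hμ m hm hm1 Φ).trans ?_
    gcongr
    linarith
  refine ⟨e₁, fun b r hr => ?_⟩
  have e₂ : eLpNorm (expLap b h) ⊤ volume ≤ ENNReal.ofReal (C * √|a| ^ ((d : ℝ) / 2)) * S := by
    refine ((eLpNorm_top_expLap_le b h).trans (H₂ a μ ha hμ hμa m hm hm1 hmb hms Φ)).trans ?_
    gcongr
    linarith
  have hθ0 : 0 ≤ 2 * (r⁻¹).toReal := by positivity
  have hθ1 : 2 * (r⁻¹).toReal ≤ 1 := by
    have h2 : (r⁻¹).toReal ≤ ((2 : ℝ≥0∞)⁻¹).toReal :=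
      ENNReal.toReal_mono (by norm_num) (ENNReal.inv_le_inv.2 hr)
    rw [ENNReal.toReal_inv 2, ENNReal.toReal_ofNat] at h2
    linarith
  set θ := 2 * (r⁻¹).toReal with hθ
  calc eLpNorm (expLap b h) r volume
      ≤ eLpNorm (expLap b h) ⊤ volume ^ (1 - θ) * eLpNorm (expLap b h) 2 volume ^ θ :=
        eLpNorm_le_rpow_mul_rpow (Lp.memLp _).1 hr
    _ ≤ (ENNReal.ofReal (C * √|a| ^ ((d : ℝ) / 2)) * S) ^ (1 - θ) *
          (ENNReal.ofReal C * S) ^ θ := by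
        rw [eLpNorm_expLap_two]
        gcongr
    _ = ENNReal.ofReal (C * √|a| ^ ((d : ℝ) * (1 / 2 - (r⁻¹).toReal))) * S := by
        rw [ENNReal.mul_rpow_of_nonneg _ _ (by linarith), ENNReal.mul_rpow_of_nonneg _ _ hθ0,
          mul_mul_mul_comm, ← ENNReal.rpow_add_of_nonneg _ _ (by linarith) hθ0, sub_add_cancel,
          ENNReal.rpow_one, ENNReal.ofReal_rpow_of_nonneg (by positivity) (by linarith),
          ENNReal.ofReal_rpow_of_nonneg hC0.le hθ0, ← ENNReal.ofReal_mul (by positivity),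
          Real.mul_rpow hC0.le (by positivity), ← Real.rpow_mul hs.le, mul_right_comm,
          ← Real.rpow_add hC0, sub_add_cancel, Real.rpow_one]
        congr 4
        rw [hθ]
        ring

/-! ### Solutions of the oscillator equation -/

theorem SolvesOscillator.continuousOn {σ ζ : ℝ → ℝ} {a b : ℝ} (h : SolvesOscillator σ ζ a b) :
    ContinuousOn ζ (Ici 0) := by
  obtain ⟨-, v, hv⟩ := h
  exact fun t ht => (hv t ht).1.continuousWithinAt

theorem SolvesOscillator.intervalIntegrable {σ ζ : ℝ → ℝ} {a b : ℝ}
    (h : SolvesOscillator σ ζ a b) (hσ : LocallyIntegrableOn σ (Ici 0)) {t : ℝ} (ht : 0 ≤ t) :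
    IntervalIntegrable (fun s => σ s * ζ s) volume 0 t := by
  have hsub : uIcc 0 t ⊆ Ici 0 := by
    rw [uIcc_of_le ht]
    exact fun x hx => hx.1
  have h1 : IntervalIntegrable σ volume 0 t := by
    rw [intervalIntegrable_iff']
    exact hσ.integrableOn_compact_subset hsub isCompact_uIcc
  exact h1.mul_continuousOn (h.continuousOn.mono hsub)

theorem SolvesOscillator.hasDerivAt {σ ζ : ℝ → ℝ} {a b : ℝ} (h : SolvesOscillator σ ζ a b)
    {t : ℝ} (ht : 0 < t) : HasDerivAt ζ (b - ∫ s in (0 : ℝ)..t, σ s * ζ s) t := by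
  obtain ⟨-, v, hv⟩ := h
  rw [← (hv t ht.le).2]
  exact (hv t ht.le).1.hasDerivAt (Ici_mem_nhds ht)

/-- The Wronskian of two solutions is constant. As `σ` is only locally integrable, the derivatives
of the solutions are merely absolutely continuous. -/
theorem SolvesOscillator.wronskian {σ ζ ξ : ℝ → ℝ} {a b a' b' : ℝ}
    (h : SolvesOscillator σ ζ a b) (h' : SolvesOscillator σ ξ a' b')
    (hσ : LocallyIntegrableOn σ (Ici 0)) {t : ℝ} (ht : 0 < t) :
    ζ t * deriv ξ t - deriv ζ t * ξ t = a * b' - b * a' := by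
  have key : ∀ {ζ : ℝ → ℝ} {a b : ℝ}, SolvesOscillator σ ζ a b →
      AbsolutelyContinuousOnInterval ζ 0 t ∧
      AbsolutelyContinuousOnInterval (fun s => b - ∫ u in (0 : ℝ)..s, σ u * ζ u) 0 t ∧
      (∀ᵐ x, x ∈ uIcc 0 t →
        HasDerivAt (fun s => b - ∫ u in (0 : ℝ)..s, σ u * ζ u) (-(σ x * ζ x)) x) := by
    intro ζ a b h
    have hi := h.intervalIntegrable hσ ht.le
    have hac : AbsolutelyContinuousOnInterval (fun s => b - ∫ u in (0 : ℝ)..s, σ u * ζ u) 0 t :=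
      (contDiffOn_const (n := 1)).absolutelyContinuousOnInterval.sub
        (hi.absolutelyContinuousOnInterval_intervalIntegral (by simp))
    refine ⟨?_, hac, ?_⟩
    · obtain ⟨M, hM⟩ := hac.exists_bound
      have hlip : LipschitzOnWith M.toNNReal ζ (uIcc 0 t) := by
        rw [uIcc_of_le ht.le] at hM ⊢
        obtain ⟨-, v, hv⟩ := h
        refine (convex_Icc 0 t).lipschitzOnWith_of_nnnorm_hasDerivWithin_le (f' := v)
          (fun x hx => (hv x hx.1).1.mono fun y hy => hy.1) fun x hx => ?_
        rw [(hv x hx.1).2, ← NNReal.coe_le_coe, coe_nnnorm]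
        exact (hM x hx).trans (Real.le_coe_toNNReal M)
      exact hlip.absolutelyContinuousOnInterval
    · filter_upwards [hi.ae_hasDerivAt_integral] with x hx hxt
      exact (hx hxt 0 (by simp)).const_sub b
  obtain ⟨h1, h2, h3⟩ := key h
  obtain ⟨h1', h2', h3'⟩ := key h'
  obtain ⟨c, hc⟩ := ((h1.mul h2').sub (h2.mul h1')).const_of_ae_hasDerivAt_zero (by
    have hne : ∀ᵐ x : ℝ, x ≠ 0 := by simp [ae_iff, measure_singleton]
    filter_upwards [h3, h3', hne] with x hx hx' hx0 hxt
    have hx1 : 0 < x := by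
      rw [uIcc_of_le ht.le] at hxt
      exact lt_of_le_of_ne hxt.1 (Ne.symm hx0)
    have := ((h.hasDerivAt hx1).mul (hx' hxt)).sub ((hx hxt).mul (h'.hasDerivAt hx1))
    convert! this using 1
    ring)
  have e0 := hc 0 (by simp)
  have e1 := hc t (by simp)
  rw [(h.hasDerivAt ht).deriv, (h'.hasDerivAt ht).deriv]
  simp only [Pi.sub_apply, Pi.mul_apply, intervalIntegral.integral_same, sub_zero, h.1, h'.1]
    at e0 e1
  rw [e1, ← e0]

theorem SolvesOscillator.hasDerivAt_deriv {σ ζ : ℝ → ℝ} {a b r₀ : ℝ}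
    (h : SolvesOscillator σ ζ a b) (hσ : LocallyIntegrableOn σ (Ici 0)) (hr₀ : 0 < r₀)
    (hc : ContinuousOn σ (Ici r₀)) {t : ℝ} (ht : r₀ < t) :
    HasDerivAt (deriv ζ) (-(σ t * ζ t)) t := by
  have ht0 : 0 < t := hr₀.trans ht
  have hcont : ContinuousOn (fun s => σ s * ζ s) (Ioi r₀) :=
    (hc.mono Ioi_subset_Ici_self).mul
      (h.continuousOn.mono fun x hx => (hr₀.trans hx).le)
  have h1 := intervalIntegral.integral_hasDerivAt_right (h.intervalIntegrable hσ ht0.le)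
    (hcont.stronglyMeasurableAtFilter isOpen_Ioi t ht) (hcont.continuousAt (Ioi_mem_nhds ht))
  refine (h1.const_sub b).congr_of_eventuallyEq ?_
  filter_upwards [Ioi_mem_nhds ht0] with s hs
  exact (h.hasDerivAt hs).deriv

/-! ### Asymptotics of functions and of their derivatives -/

/-- A derivative that is eventually nonzero is eventually positive, if the function has increments
of positive sign arbitrarily far out. -/
theorem eventually_pos_of_hasDerivAt {f f' : ℝ → ℝ} {r : ℝ}
    (hf : ∀ t, r < t → HasDerivAt f (f' t) t) (hf' : ContinuousOn f' (Ioi r))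
    (h0 : ∀ᶠ t in atTop, f' t ≠ 0) (hinc : ∀ᶠ t in atTop, ∃ s, t < s ∧ f t < f s) :
    ∀ᶠ t in atTop, 0 < f' t := by
  obtain ⟨T, hT⟩ := eventually_atTop.1 (h0.and (hinc.and (eventually_gt_atTop r)))
  obtain ⟨-, ⟨s, hTs, hs⟩, hrT⟩ := hT T le_rfl
  obtain ⟨u, hu, hfu⟩ := exists_hasDerivAt_eq_slope f f' hTs
    (fun x hx => (hf x (hrT.trans_le hx.1)).continuousAt.continuousWithinAt)
    (fun x hx => hf x (hrT.trans hx.1))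
  have hu0 : 0 < f' u := by
    rw [hfu]
    exact div_pos (sub_pos.2 hs) (sub_pos.2 hTs)
  filter_upwards [eventually_ge_atTop T] with t ht
  by_contra! hneg
  have hsub : uIcc t u ⊆ Ici T := fun x hx => (le_min ht hu.1.le).trans hx.1
  obtain ⟨x, hx, hx0⟩ := intermediate_value_uIcc
    (hf'.mono fun x hx => hrT.trans_le (hsub hx))
    (show (0 : ℝ) ∈ uIcc (f' t) (f' u) from ⟨(min_le_left _ _).trans hneg,
      hu0.le.trans (le_max_right _ _)⟩)
  exact (hT x (hsub hx)).1 hx0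

/-- If `f ~ A t ^ p` and `f' ~ B t ^ (p - 1)` with `p > 0`, then `p A ≤ B`. -/
theorem mul_le_of_tendsto_div_rpow {f f' : ℝ → ℝ} {p A B : ℝ} (hp : 0 < p)
    (hf : ∀ᶠ t in atTop, HasDerivAt f (f' t) t)
    (hA : Tendsto (fun t => f t / t ^ p) atTop (𝓝 A))
    (hB : Tendsto (fun t => f' t / t ^ (p - 1)) atTop (𝓝 B)) : p * A ≤ B := by
  by_contra! hlt
  have hlt' : B / p < A := by
    rw [div_lt_iff₀ hp]
    linarith
  obtain ⟨k, hBk, hkA⟩ := exists_between hlt'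
  rw [div_lt_iff₀ hp] at hBk
  obtain ⟨T, hT⟩ := eventually_atTop.1 (hf.and
    ((hB.eventually (gt_mem_nhds hBk)).and (eventually_gt_atTop 0)))
  -- `f - k t ^ p` is decreasing, but tends to infinity
  have hder : ∀ t, T ≤ t → HasDerivAt (fun t => f t - k * t ^ p) (f' t - k * (p * t ^ (p - 1))) t :=
    fun t ht => (hT t ht).1.sub
      ((Real.hasDerivAt_rpow_const (Or.inl (hT t ht).2.2.ne')).const_mul k)
  have hanti : AntitoneOn (fun t => f t - k * t ^ p) (Ici T) := by
    refine antitoneOn_of_deriv_nonpos (convex_Ici T)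
      (fun t ht => (hder t ht).continuousAt.continuousWithinAt)
      (fun t ht => (hder t (interior_subset ht)).differentiableAt.differentiableWithinAt)
      fun t ht => ?_
    obtain ⟨-, h2, h3⟩ := hT t (interior_subset ht)
    rw [(hder t (interior_subset ht)).deriv]
    rw [div_lt_iff₀ (Real.rpow_pos_of_pos h3 _)] at h2
    linarith
  have hinf : Tendsto (fun t => (f t / t ^ p - k) * t ^ p) atTop atTop :=
    (hA.sub_const k).pos_mul_atTop (by linarith) (tendsto_rpow_atTop hp)
  obtain ⟨t, ht, ht'⟩ := ((hinf.eventually_gt_atTop (f T - k * T ^ p)).and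
    (eventually_ge_atTop T)).exists
  have h3 := (hT t ht').2.2
  have h4 := hanti self_mem_Ici ht' ht'
  have h5 : (f t / t ^ p - k) * t ^ p = f t - k * t ^ p := by
    have := (Real.rpow_pos_of_pos h3 p).ne'
    field_simp
  simp only at h4
  linarith

theorem eventually_mul_rpow_lt_of_tendsto {f : ℝ → ℝ} {p A : ℝ} (hA : 0 < A)
    (h : Tendsto (fun t => f t / t ^ p) atTop (𝓝 A)) :
    ∀ᶠ t in atTop, A / 2 * t ^ p < f t ∧ f t < 2 * A * t ^ p := by
  filter_upwards [h.eventually (lt_mem_nhds (half_lt_self hA)),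
    h.eventually (gt_mem_nhds (by linarith : A < 2 * A)), eventually_gt_atTop 0] with t h1 h2 h3
  have := Real.rpow_pos_of_pos h3 p
  exact ⟨(lt_div_iff₀ this).1 h1, (div_lt_iff₀ this).1 h2⟩

/-! ### Size of the coefficients -/

/-- The asymptotic sign conditions and sizes of the fundamental solutions and their derivatives. -/
theorem TimeDecay.eventually_bounds {σ ζ₁ ζ₂ : ℝ → ℝ} {r₀ lam : ℝ}
    (hA : TimeDecay σ ζ₁ ζ₂ r₀ lam) (hpos : ∀ t, r₀ < t → 0 ≤ ζ₁ t ∧ 0 ≤ ζ₂ t)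
    (hlam0 : 0 < lam) :
    ∃ c M θ : ℝ, 0 < c ∧ 0 < M ∧ θ < 1 ∧ ∀ᶠ t in atTop,
      (0 < ζ₁ t ∧ ζ₁ t ≤ M * t ^ lam) ∧ c * t ^ (1 - lam) ≤ ζ₂ t ∧
      0 < deriv ζ₁ t ∧ (c * t ^ (-lam) ≤ deriv ζ₂ t ∧ deriv ζ₂ t ≤ M * t ^ (-lam)) ∧
      0 ≤ σ t * ζ₂ t ^ 2 ∧ σ t * ζ₂ t ^ 2 ≤ θ * deriv ζ₂ t ^ 2 ∧
      ζ₁ t * deriv ζ₂ t ≤ M := by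
  obtain ⟨c₁, c₂, c₃, hc, -⟩ := hA.asymptotics
  obtain ⟨hc10, hc20, h10, h20⟩ := hc 0 (by norm_num)
  obtain ⟨hc11, hc21, h11, h21⟩ := hc 1 (by norm_num)
  obtain ⟨-, hc22, -, h22⟩ := hc 2 le_rfl
  have hlam := hA.lam_lt
  have hr₀ := hA.r₀_pos
  have hlim : ∀ {g : ℝ → ℝ} {q l : ℝ}, l ≠ 0 →
      Tendsto (fun t => |g t| / t ^ q) atTop (𝓝 l) →
      0 < l ∧ ∀ᶠ t in atTop, g t ≠ 0 := by
    intro g q l hl h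
    have hl0 : 0 < l := lt_of_le_of_ne (ge_of_tendsto h (by
      filter_upwards [eventually_ge_atTop 0] with t ht
      exact div_nonneg (abs_nonneg _) (Real.rpow_nonneg ht _))) (Ne.symm hl)
    refine ⟨hl0, ?_⟩
    filter_upwards [h.eventually (lt_mem_nhds hl0)] with t ht h0
    simp [h0] at ht
  have habs : ∀ {g : ℝ → ℝ} {q q' l : ℝ}, q = q' → (∀ᶠ t in atTop, 0 ≤ g t) →
      Tendsto (fun t => |g t| / t ^ q) atTop (𝓝 l) →
      Tendsto (fun t => g t / t ^ q') atTop (𝓝 l) := by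
    rintro g q q' l rfl hg h
    refine h.congr' ?_
    filter_upwards [hg] with t ht
    rw [abs_of_nonneg ht]
  have i2 : ∀ ζ : ℝ → ℝ, iteratedDeriv 2 ζ = deriv (deriv ζ) := fun ζ => by
    rw [iteratedDeriv_succ, iteratedDeriv_one]
  simp only [iteratedDeriv_zero, Nat.cast_zero, sub_zero] at h10 h20
  simp only [iteratedDeriv_one, Nat.cast_one] at h11 h21
  rw [i2] at h22
  have dd : ∀ {ζ : ℝ → ℝ} {a b : ℝ}, SolvesOscillator σ ζ a b → ∀ t, r₀ < t →
      HasDerivAt ζ (deriv ζ t) t := fun h t ht => by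
    have := h.hasDerivAt (hr₀.trans ht)
    rwa [this.deriv]
  have dd2 : ∀ {ζ : ℝ → ℝ} {a b : ℝ}, SolvesOscillator σ ζ a b → ∀ t, r₀ < t →
      HasDerivAt (deriv ζ) (-(σ t * ζ t)) t := fun h t ht =>
    h.hasDerivAt_deriv hA.locallyIntegrable hr₀ hA.contDiffOn.continuousOn ht
  have dc : ∀ {ζ : ℝ → ℝ} {a b : ℝ}, SolvesOscillator σ ζ a b →
      ContinuousOn (deriv ζ) (Ioi r₀) := fun h t ht =>
    (dd2 h t ht).continuousAt.continuousWithinAt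
  have k10 := habs rfl ((eventually_gt_atTop r₀).mono fun t ht => (hpos t ht).1) h10
  have k20 := habs rfl ((eventually_gt_atTop r₀).mono fun t ht => (hpos t ht).2) h20
  -- both solutions tend to infinity
  have hinf : ∀ {g : ℝ → ℝ} {q l : ℝ}, 0 < q → 0 < l →
      Tendsto (fun t => g t / t ^ q) atTop (𝓝 l) → Tendsto g atTop atTop := by
    intro g q l hq hl h
    refine (h.pos_mul_atTop hl (tendsto_rpow_atTop hq)).congr' ?_
    filter_upwards [eventually_gt_atTop 0] with t ht
    have := (Real.rpow_pos_of_pos ht q).ne'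
    field_simp
  have inf1 := hinf hlam0 (hlim hc10 h10).1 k10
  have inf2 := hinf (by linarith) (hlim hc20 h20).1 k20
  have hinc : ∀ {g : ℝ → ℝ}, Tendsto g atTop atTop →
      ∀ᶠ t in atTop, ∃ s, t < s ∧ g t < g s := fun {g} h => Eventually.of_forall fun t =>
    ((eventually_gt_atTop t).and (h.eventually_gt_atTop (g t))).exists
  have p11 := eventually_pos_of_hasDerivAt (dd hA.solves₁) (dc hA.solves₁) (hlim hc11 h11).2
    (hinc inf1)
  have p21 := eventually_pos_of_hasDerivAt (dd hA.solves₂) (dc hA.solves₂) (hlim hc21 h21).2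
    (hinc inf2)
  have k21 := habs (show 1 - lam - 1 = -lam by ring) (p21.mono fun t ht => ht.le) h21
  -- the derivative of `ζ₂` is positive and tends to zero, so `ζ₂` is eventually concave
  have z21 : Tendsto (deriv ζ₂) atTop (𝓝 0) := by
    have := k21.mul (tendsto_rpow_neg_atTop hlam0)
    rw [mul_zero] at this
    refine this.congr' ?_
    filter_upwards [eventually_gt_atTop 0] with t ht
    have := (Real.rpow_pos_of_pos ht (-lam)).ne'
    field_simp
  have p22 : ∀ᶠ t in atTop, 0 < σ t * ζ₂ t := by
    refine eventually_pos_of_hasDerivAt (f := fun t => -deriv ζ₂ t) (r := r₀)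
      (fun t ht => ?_) ?_ ?_ ?_
    · have := (dd2 hA.solves₂ t ht).neg
      rw [neg_neg] at this
      exact this
    · exact (hA.contDiffOn.continuousOn.mono Ioi_subset_Ici_self).mul
        fun t ht => (dd hA.solves₂ t ht).continuousAt.continuousWithinAt
    · filter_upwards [(hlim hc22 h22).2, eventually_gt_atTop r₀] with t ht ht' h0
      rw [(dd2 hA.solves₂ t ht').deriv, h0, neg_zero] at ht
      exact ht rfl
    · filter_upwards [p21] with t ht
      obtain ⟨s, hs, hs'⟩ :=
        ((eventually_gt_atTop t).and (z21.eventually (gt_mem_nhds ht))).exists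
      exact ⟨s, hs, neg_lt_neg hs'⟩
  have k22 : Tendsto (fun t => σ t * ζ₂ t / t ^ (-lam - 1)) atTop (𝓝 (c₂ 2)) := by
    refine h22.congr' ?_
    filter_upwards [p22, eventually_gt_atTop r₀] with t ht ht'
    rw [(dd2 hA.solves₂ t ht').deriv, abs_neg, abs_of_pos ht]
    congr 2
    push_cast
    ring
  -- relations between the constants of the asymptotics
  have r1 : (1 - lam) * c₂ 0 ≤ c₂ 1 := by
    refine mul_le_of_tendsto_div_rpow (by linarith)
      ((eventually_gt_atTop r₀).mono (dd hA.solves₂)) k20 ?_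
    rwa [show 1 - lam - 1 = -lam by ring]
  have r2 : c₂ 1 = c₂ 2 / lam := by
    refine tendsto_nhds_unique k21 (HasDerivAt.lhopital_zero_atTop
      (f' := fun t => -(σ t * ζ₂ t)) (g' := fun t => -lam * t ^ (-lam - 1))
      ((eventually_gt_atTop r₀).mono (dd2 hA.solves₂))
      ((eventually_gt_atTop 0).mono fun t ht => Real.hasDerivAt_rpow_const (Or.inl ht.ne'))
      ((eventually_gt_atTop 0).mono fun t ht => ?_) z21 (tendsto_rpow_neg_atTop hlam0) ?_)
    · exact mul_ne_zero (neg_ne_zero.2 hlam0.ne') (Real.rpow_pos_of_pos ht _).ne'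
    · refine (k22.div_const lam).congr' ?_
      filter_upwards [eventually_gt_atTop 0] with t ht
      have := (Real.rpow_pos_of_pos ht (-lam - 1)).ne'
      field_simp
  have pc10 := (hlim hc10 h10).1
  have pc20 := (hlim hc20 h20).1
  have pc21 := (hlim hc21 h21).1
  have pc22 := (hlim hc22 h22).1
  have hratio : c₂ 2 * c₂ 0 / c₂ 1 ^ 2 < 1 := by
    rw [div_lt_one (by positivity)]
    have e : c₂ 2 = lam * c₂ 1 := by
      rw [r2]
      field_simp
    rw [e]
    nlinarith [mul_pos pc21 pc20, mul_pos hlam0 (mul_pos pc21 pc20)]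
  have hlimr : Tendsto (fun t => σ t * ζ₂ t ^ 2 / deriv ζ₂ t ^ 2) atTop
      (𝓝 (c₂ 2 * c₂ 0 / c₂ 1 ^ 2)) := by
    refine ((k22.mul k20).div (k21.pow 2) (by positivity)).congr' ?_
    filter_upwards [eventually_gt_atTop 0] with t ht
    have e1 : t ^ (-lam - 1) * t ^ (1 - lam) = (t ^ (-lam)) ^ 2 := by
      rw [← Real.rpow_add ht, ← Real.rpow_natCast, ← Real.rpow_mul ht.le]
      congr 1
      push_cast
      ring
    have := (Real.rpow_pos_of_pos ht (-lam)).ne'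
    simp only [Pi.div_apply]
    rw [div_mul_div_comm, e1, div_pow, div_div_div_cancel_right₀ (by positivity)]
    ring
  obtain ⟨θ, hθ, hθ1⟩ := exists_between hratio
  refine ⟨min (c₂ 0 / 2) (c₂ 1 / 2), 2 * c₁ 0 + 2 * c₂ 1 + 2 * c₁ 0 * (2 * c₂ 1), θ,
    by positivity, by positivity, hθ1, ?_⟩
  filter_upwards [eventually_mul_rpow_lt_of_tendsto pc10 k10,
    eventually_mul_rpow_lt_of_tendsto pc20 k20, eventually_mul_rpow_lt_of_tendsto pc21 k21,
    p11, p21, p22, hlimr.eventually (gt_mem_nhds hθ), eventually_gt_atTop 0]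
    with t a1 a2 a3 a4 a5 a6 a7 ht
  have q1 := Real.rpow_pos_of_pos ht lam
  have q2 := Real.rpow_pos_of_pos ht (1 - lam)
  have q3 := Real.rpow_pos_of_pos ht (-lam)
  have z1 : 0 < ζ₁ t := lt_trans (by positivity) a1.1
  have z2 : 0 < ζ₂ t := lt_trans (by positivity) a2.1
  refine ⟨⟨z1, a1.2.le.trans ?_⟩, le_trans ?_ a2.1.le, a4, ⟨le_trans ?_ a3.1.le, a3.2.le.trans ?_⟩,
    ?_, ?_, ?_⟩
  · gcongr
    nlinarith [mul_pos pc10 pc21]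
  · gcongr
    exact min_le_left _ _
  · gcongr
    exact min_le_right _ _
  · gcongr
    nlinarith [mul_pos pc10 pc21]
  · rw [pow_two, ← mul_assoc]
    positivity
  · exact ((div_lt_iff₀ (by positivity)).1 a7).le
  · calc ζ₁ t * deriv ζ₂ t ≤ (2 * c₁ 0 * t ^ lam) * (2 * c₂ 1 * t ^ (-lam)) := by
          gcongr
          exacts [a1.2.le, a3.2.le]
      _ = 2 * c₁ 0 * (2 * c₂ 1) * (t ^ lam * t ^ (-lam)) := by ring
      _ = 2 * c₁ 0 * (2 * c₂ 1) := by
          rw [← Real.rpow_add ht, add_neg_cancel, Real.rpow_zero, mul_one]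
      _ ≤ _ := by linarith

/-- The derivative of `A_n`; the Wronskian relation removes `ζ₁`, `ζ₁'` from the numerator. -/
theorem hasDerivAt_coeffA {σ ζ₁ ζ₂ : ℝ → ℝ} {n : ℤ} {t : ℝ}
    (h₁ : HasDerivAt ζ₁ (deriv ζ₁ t) t) (h₂ : HasDerivAt ζ₂ (deriv ζ₂ t) t)
    (h₃ : HasDerivAt (deriv ζ₂) (-(σ t * ζ₂ t)) t)
    (hW : ζ₁ t * deriv ζ₂ t - deriv ζ₁ t * ζ₂ t = 1) (hC : coeffC ζ₁ ζ₂ n t ≠ 0) :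
    HasDerivAt (coeffA ζ₁ ζ₂ n)
      ((n - 1) * (n * deriv ζ₂ t ^ 2 - σ t * ζ₂ t ^ 2) / (2 * coeffC ζ₁ ζ₂ n t ^ 2)) t := by
  unfold coeffC at hC ⊢
  have hnum := (h₂.const_mul ((n : ℝ) - 1)).mul h₃
  have hden := (((h₁.const_mul ((n : ℝ) - 1)).mul h₃).const_add 1).const_mul 2
  have := hnum.div hden (mul_ne_zero two_ne_zero hC)
  convert! this using 1
  simp only [Pi.mul_apply]
  rw [div_eq_div_iff (mul_ne_zero two_ne_zero (pow_ne_zero 2 hC))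
    (pow_ne_zero 2 (mul_ne_zero two_ne_zero hC))]
  linear_combination (-4 * (n - 1) ^ 2 * deriv ζ₂ t ^ 2 *
    (1 + (n - 1) * ζ₁ t * deriv ζ₂ t) ^ 2) * hW

theorem intCast_le_neg_one_or_two_le {n : ℤ} (hn0 : n ≠ 0) (hn1 : n ≠ 1) :
    (n : ℝ) ≤ -1 ∨ 2 ≤ (n : ℝ) := by
  rcases lt_or_gt_of_ne hn0 with h | h
  · exact Or.inl (by exact_mod_cast (by omega : n ≤ -1))
  · exact Or.inr (by exact_mod_cast (by omega : 2 ≤ n))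

theorem abs_intCast_sub_one_bounds {n : ℤ} (hn0 : n ≠ 0) (hn1 : n ≠ 1) :
    1 ≤ |(n : ℝ)| ∧ |(n : ℝ)| / 2 ≤ |(n : ℝ) - 1| ∧ |(n : ℝ) - 1| ≤ 2 * |(n : ℝ)| := by
  rcases intCast_le_neg_one_or_two_le hn0 hn1 with h | h
  · rw [abs_of_nonpos (by linarith), abs_of_nonpos (by linarith)]
    refine ⟨?_, ?_, ?_⟩ <;> linarith
  · rw [abs_of_nonneg (by linarith), abs_of_nonneg (by linarith)]
    refine ⟨?_, ?_, ?_⟩ <;> linarith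

theorem abs_intCast_le_abs_one_add {n : ℤ} (hn0 : n ≠ 0) (hn1 : n ≠ 1) {w : ℝ} (hw : 1 ≤ w) :
    |(n : ℝ)| ≤ |1 + ((n : ℝ) - 1) * w| := by
  rcases intCast_le_neg_one_or_two_le hn0 hn1 with h | h
  · rw [abs_of_nonpos (by linarith : (n : ℝ) ≤ 0)]
    refine le_trans ?_ (neg_le_abs _)
    nlinarith
  · rw [abs_of_nonneg (by linarith : (0 : ℝ) ≤ n)]
    refine le_trans ?_ (le_abs_self _)
    nlinarith

/-- Sizes of `C_n`, `t A_n'` and `B_n` for large `t`, uniformly in `n ≠ 0, 1`. -/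
theorem TimeDecay.exists_coeff_bounds {σ ζ₁ ζ₂ : ℝ → ℝ} {r₀ lam : ℝ}
    (hA : TimeDecay σ ζ₁ ζ₂ r₀ lam) (hpos : ∀ t, r₀ < t → 0 ≤ ζ₁ t ∧ 0 ≤ ζ₂ t)
    (hlam0 : 0 < lam) :
    ∃ T₀ c M : ℝ, 1 ≤ T₀ ∧ r₀ < T₀ ∧ 0 < c ∧ 0 < M ∧ ∀ t, T₀ ≤ t → ∀ n : ℤ, n ≠ 0 → n ≠ 1 →
      ζ₂ t ≠ 0 ∧ DifferentiableAt ℝ (coeffA ζ₁ ζ₂ n) t ∧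
      |(n : ℝ)| ≤ |coeffC ζ₁ ζ₂ n t| ∧ |coeffC ζ₁ ζ₂ n t| ≤ M * |(n : ℝ)| ∧
      c * t ^ (1 - 2 * lam) ≤ |t * deriv (coeffA ζ₁ ζ₂ n) t| ∧
      |t * deriv (coeffA ζ₁ ζ₂ n) t| ≤ M * t ^ (1 - 2 * lam) ∧
      |coeffB ζ₁ ζ₂ n t| * t ^ (1 - 2 * lam) ≤ M * |(n : ℝ)| := by
  obtain ⟨c, M, θ, hc, hM, hθ, hev⟩ := hA.eventually_bounds hpos hlam0
  obtain ⟨T, hT⟩ := eventually_atTop.1 hev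
  have hr₀ := hA.r₀_pos
  have hθ' : 0 < 1 - θ := by linarith
  set N := 2 * M + 1 with hN
  refine ⟨max T (max 1 (r₀ + 1)), (1 - θ) * c ^ 2 / (4 * N ^ 2), N + 2 * M ^ 2 + M * N / c,
    le_max_of_le_right (le_max_left _ _),
    lt_of_lt_of_le (lt_add_one r₀) (le_max_of_le_right (le_max_right _ _)),
    by positivity, by positivity, fun t ht n hn0 hn1 => ?_⟩
  have htT : T ≤ t := (le_max_left _ _).trans ht
  have ht1 : 1 ≤ t := ((le_max_left _ _).trans (le_max_right T _)).trans ht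
  have htr : r₀ < t := by
    have : r₀ + 1 ≤ t := ((le_max_right _ _).trans (le_max_right T _)).trans ht
    linarith
  have ht0 : 0 < t := by linarith
  obtain ⟨⟨z1, z1'⟩, z2, w1, ⟨w2, w2'⟩, s0, s1, hwM⟩ := hT t htT
  have hW := hA.solves₁.wronskian hA.solves₂ hA.locallyIntegrable ht0
  have d1 := hA.solves₁.hasDerivAt ht0
  have d2 := hA.solves₂.hasDerivAt ht0
  have d3 := hA.solves₂.hasDerivAt_deriv hA.locallyIntegrable hr₀ hA.contDiffOn.continuousOn htr
  rw [← d1.deriv] at d1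
  rw [← d2.deriv] at d2
  have q1 := Real.rpow_pos_of_pos ht0 (1 - lam)
  have q2 := Real.rpow_pos_of_pos ht0 (-lam)
  have q3 := Real.rpow_pos_of_pos ht0 (1 - 2 * lam)
  have q4 := Real.rpow_pos_of_pos ht0 lam
  have e1 : t * (t ^ (-lam)) ^ 2 = t ^ (1 - 2 * lam) := by
    rw [← Real.rpow_natCast, ← Real.rpow_mul ht0.le]
    nth_rewrite 1 [← Real.rpow_one t]
    rw [← Real.rpow_add ht0]
    congr 1
    push_cast
    ring
  have e2 : t ^ lam * t ^ (1 - 2 * lam) = t ^ (1 - lam) := by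
    rw [← Real.rpow_add ht0]
    congr 1
    ring
  have z2p : 0 < ζ₂ t := lt_of_lt_of_le (by positivity) z2
  have w2p : 0 < deriv ζ₂ t := lt_of_lt_of_le (by positivity) w2
  -- the Wronskian relation bounds `ζ₁ ζ₂'` from below
  have hw1 : 1 ≤ ζ₁ t * deriv ζ₂ t := by nlinarith [mul_pos w1 z2p]
  set w := ζ₁ t * deriv ζ₂ t with hw
  have hCw : coeffC ζ₁ ζ₂ n t = 1 + ((n : ℝ) - 1) * w := by
    rw [coeffC, hw]
    ring
  obtain ⟨hnabs, hn1l, hn1u⟩ := abs_intCast_sub_one_bounds hn0 hn1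
  have hCl : |(n : ℝ)| ≤ |coeffC ζ₁ ζ₂ n t| := hCw ▸ abs_intCast_le_abs_one_add hn0 hn1 hw1
  have hCu : |coeffC ζ₁ ζ₂ n t| ≤ N * |(n : ℝ)| := by
    calc |coeffC ζ₁ ζ₂ n t| ≤ 1 + |(n : ℝ) - 1| * w := by
          rw [hCw]
          refine (abs_add_le _ _).trans ?_
          rw [abs_one, abs_mul, abs_of_pos (by linarith : 0 < w)]
      _ ≤ |(n : ℝ)| + 2 * |(n : ℝ)| * M := by gcongr
      _ = N * |(n : ℝ)| := by
          rw [hN]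
          ring
  have hC0 : coeffC ζ₁ ζ₂ n t ≠ 0 := by
    rw [← abs_pos]
    linarith
  have hdA := hasDerivAt_coeffA (n := n) d1 d2 d3 (by linarith) hC0
  set D := deriv ζ₂ t with hD
  set s := σ t * ζ₂ t ^ 2 with hs
  have hD2 : 0 < D ^ 2 := by positivity
  have hsD : s ≤ D ^ 2 := s1.trans (mul_le_of_le_one_left hD2.le hθ.le)
  have hnum_l : (1 - θ) * (|(n : ℝ)| * D ^ 2) ≤ |n * D ^ 2 - s| := by
    have h1 : |(n : ℝ)| * D ^ 2 - s ≤ |n * D ^ 2 - s| := by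
      have := abs_sub_abs_le_abs_sub ((n : ℝ) * D ^ 2) s
      rwa [abs_mul, abs_of_pos hD2, abs_of_nonneg s0] at this
    have h2 : s ≤ θ * (|(n : ℝ)| * D ^ 2) := by
      rcases le_or_gt 0 θ with h | h
      · refine s1.trans ?_
        gcongr
        exact le_mul_of_one_le_left hD2.le hnabs
      · exact absurd s0 (not_le.2 (s1.trans_lt (mul_neg_of_neg_of_pos h hD2)))
    linarith
  have hnum_u : |n * D ^ 2 - s| ≤ 2 * (|(n : ℝ)| * D ^ 2) := by
    rw [sub_eq_add_neg]
    refine (abs_add_le _ _).trans ?_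
    rw [abs_neg, abs_mul, abs_of_pos hD2, abs_of_nonneg s0]
    linarith [le_mul_of_one_le_left hD2.le hnabs]
  have habs : |t * deriv (coeffA ζ₁ ζ₂ n) t| =
      t * (|(n : ℝ) - 1| * |n * D ^ 2 - s| / (2 * |coeffC ζ₁ ζ₂ n t| ^ 2)) := by
    rw [hdA.deriv, abs_mul, abs_of_pos ht0, abs_div, abs_mul, abs_mul, abs_pow, abs_two]
  have hNM : 0 ≤ M * N / c := by positivity
  refine ⟨z2p.ne', hdA.differentiableAt, hCl, hCu.trans ?_, ?_, ?_, ?_⟩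
  · gcongr
    linarith [sq_nonneg M]
  · rw [habs]
    calc (1 - θ) * c ^ 2 / (4 * N ^ 2) * t ^ (1 - 2 * lam)
        = t * (|(n : ℝ)| / 2 * ((1 - θ) * (|(n : ℝ)| * (c * t ^ (-lam)) ^ 2)) /
            (2 * (N * |(n : ℝ)|) ^ 2)) := by
          rw [← e1]
          field_simp
          ring
      _ ≤ t * (|(n : ℝ) - 1| * |n * D ^ 2 - s| / (2 * |coeffC ζ₁ ζ₂ n t| ^ 2)) := by
          gcongr
          refine le_trans ?_ hnum_l
          gcongr
  · rw [habs]
    calc t * (|(n : ℝ) - 1| * |n * D ^ 2 - s| / (2 * |coeffC ζ₁ ζ₂ n t| ^ 2))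
        ≤ t * (2 * |(n : ℝ)| * (2 * (|(n : ℝ)| * (M * t ^ (-lam)) ^ 2)) /
            (2 * |(n : ℝ)| ^ 2)) := by
          gcongr
          refine hnum_u.trans ?_
          gcongr
      _ = 2 * M ^ 2 * t ^ (1 - 2 * lam) := by
          rw [← e1]
          field_simp
      _ ≤ _ := by
          gcongr
          linarith [hM]
  · have hB : coeffB ζ₁ ζ₂ n t = ζ₁ t * coeffC ζ₁ ζ₂ n t / (2 * ζ₂ t) := rfl
    rw [hB, abs_div, abs_mul, abs_of_pos z1, abs_of_pos (by positivity : 0 < 2 * ζ₂ t)]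
    calc ζ₁ t * |coeffC ζ₁ ζ₂ n t| / (2 * ζ₂ t) * t ^ (1 - 2 * lam)
        ≤ M * t ^ lam * (N * |(n : ℝ)|) / (2 * (c * t ^ (1 - lam))) * t ^ (1 - 2 * lam) := by
          gcongr
      _ = M * N / c / 2 * |(n : ℝ)| := by
          rw [← e2]
          field_simp
      _ ≤ _ := by
          gcongr
          linarith [sq_nonneg M]

/-! ### The symbol of the dilated operator -/

/-- The symbol `e^{-ib|ξ|²} ψ(τ ξ / R)` of `e^{ibΔ} 𝒟(τ) 𝒦 𝒟(τ)⁻¹`. -/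
def symG (ψ : Cutoff d) (b τ R : ℝ) (ξ : EuclideanSpace ℝ (Fin d)) : ℂ :=
  Complex.exp (((-(b * ‖ξ‖ ^ 2) : ℝ) : ℂ) * Complex.I) * ((ψ.toFun (R⁻¹ • τ • ξ) : ℝ) : ℂ)

theorem norm_symG_le (ψ : Cutoff d) (b τ R : ℝ) (ξ : EuclideanSpace ℝ (Fin d)) :
    ‖symG ψ b τ R ξ‖ ≤ 1 := by
  rw [symG, norm_mul, Complex.norm_exp_ofReal_mul_I, one_mul, Complex.norm_real,
    Real.norm_of_nonneg (ψ.nonneg _)]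
  exact ψ.le_one _

theorem bddSymbol_symG (ψ : Cutoff d) (b τ R : ℝ) : BddSymbol (symG ψ b τ R) :=
  ⟨(bddSymbol_schrodinger b).1.mul ((bddSymbol_cutoff ψ R⁻¹).comp_smul τ).1, 1,
    norm_symG_le ψ b τ R⟩

theorem opG_eq {lam : ℝ} {ζ₁ ζ₂ : ℝ → ℝ} (ψ : Cutoff d) {n : ℤ} {t : ℝ}
    (hC : coeffC ζ₁ ζ₂ n t ≠ 0) (φ : L2 d) :
    opG lam ζ₁ ζ₂ ψ n t φ =
      mulOp (regFun d (t * deriv (coeffA ζ₁ ζ₂ n) t)) (bddSymbol_regFun _)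
        (fourierMul (symG ψ (coeffB ζ₁ ζ₂ n t) (coeffC ζ₁ ζ₂ n t)
          (|(n : ℝ)| * t ^ ((1 - 2 * lam) / 2))) (bddSymbol_symG _ _ _ _)
          (dilation (coeffC ζ₁ ζ₂ n t) φ)) := by
  rw [opG, regularizer, dilation_fourierMul hC, expLap,
    fourierMul_fourierMul _ _ _ _ (bddSymbol_symG _ _ _ _)]
  rfl

theorem symG_eq_zero (ψ : Cutoff d) (b : ℝ) {τ R : ℝ} (hR : 0 < R)
    {ξ : EuclideanSpace ℝ (Fin d)} (h : 2 * R < |τ| * ‖ξ‖) : symG ψ b τ R ξ = 0 := by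
  rw [symG, ψ.eq_zero, Complex.ofReal_zero, mul_zero]
  rw [norm_smul, norm_smul, Real.norm_eq_abs τ, norm_inv, Real.norm_of_nonneg hR.le,
    lt_inv_mul_iff₀ hR]
  linarith

theorem norm_cutoff_sub_one_le (ψ : Cutoff d) (y : EuclideanSpace ℝ (Fin d)) :
    ‖((ψ.toFun y : ℝ) : ℂ) - 1‖ ≤ 1 ∧ (‖y‖ ≤ 1 → ‖((ψ.toFun y : ℝ) : ℂ) - 1‖ = 0) := by
  constructor
  · rw [← Complex.ofReal_one, ← Complex.ofReal_sub, Complex.norm_real, Real.norm_eq_abs, abs_le]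
    constructor <;> linarith [ψ.nonneg y, ψ.le_one y]
  · intro h
    rw [ψ.eq_one y h]
    simp

/-- With `N = t ^ {ρ/2}`, `k = |n|`, `|C_n| ≤ M k` and `|B_n| N ^ 2 ≤ M k`, the symbol is close to
`1` for frequencies below `N / √k`. -/
theorem norm_symG_sub_one_le (ψ : Cutoff d) {b τ N k M : ℝ} (hN : 0 < N) (hk : 1 ≤ k) (hM : 0 < M)
    (hb : |b| * N ^ 2 ≤ M * k) (hτ : |τ| ≤ M * k) (ξ : EuclideanSpace ℝ (Fin d)) :
    ‖symG ψ b τ (k * N) ξ - 1‖ ≤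
      (3 + M + M ^ 2) * min 1 (‖(N * k ^ (-(1 / 2 : ℝ)))⁻¹ • ξ‖ ^ 2) := by
  have hk0 : 0 < k := by linarith
  have hx : ‖(N * k ^ (-(1 / 2 : ℝ)))⁻¹ • ξ‖ ^ 2 = k * ‖ξ‖ ^ 2 / N ^ 2 := by
    have e : (k ^ (-(1 / 2 : ℝ))) ^ 2 = k⁻¹ := by
      rw [← Real.rpow_natCast, ← Real.rpow_mul hk0.le, ← Real.rpow_neg_one]
      norm_num
    rw [norm_smul, norm_inv, Real.norm_of_nonneg (by positivity), mul_pow, inv_pow, mul_pow, e]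
    field_simp
  rw [hx]
  set x := k * ‖ξ‖ ^ 2 / N ^ 2 with hxdef
  have hx0 : 0 ≤ x := by positivity
  set y := (k * N)⁻¹ • τ • ξ with hy
  set E := Complex.exp (((-(b * ‖ξ‖ ^ 2) : ℝ) : ℂ) * Complex.I) with hE
  have hEn : ‖E‖ = 1 := Complex.norm_exp_ofReal_mul_I _
  have h1 : ‖symG ψ b τ (k * N) ξ - 1‖ ≤ ‖E - 1‖ + ‖((ψ.toFun y : ℝ) : ℂ) - 1‖ := by
    have : symG ψ b τ (k * N) ξ - 1 = (E - 1) + E * (((ψ.toFun y : ℝ) : ℂ) - 1) := by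
      rw [symG]
      ring
    rw [this]
    refine (norm_add_le _ _).trans ?_
    rw [norm_mul, hEn, one_mul]
  have h2 : ‖E - 1‖ ≤ (2 + M) * min 1 x := by
    rw [mul_min_of_nonneg _ _ (by positivity)]
    refine le_min ?_ ?_
    · refine (norm_sub_le _ _).trans ?_
      rw [hEn, norm_one]
      linarith
    · calc ‖E - 1‖ ≤ ‖-(b * ‖ξ‖ ^ 2)‖ := by
            rw [hE, mul_comm]
            exact Real.norm_exp_I_mul_ofReal_sub_one_le
        _ = |b| * N ^ 2 * (‖ξ‖ ^ 2 / N ^ 2) := by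
            rw [norm_neg, norm_mul, Real.norm_eq_abs, norm_pow, norm_norm]
            field_simp
        _ ≤ M * k * (‖ξ‖ ^ 2 / N ^ 2) := by gcongr
        _ = M * x := by
            rw [hxdef]
            ring
        _ ≤ (2 + M) * x := by
            gcongr
            linarith
  have h3 : ‖((ψ.toFun y : ℝ) : ℂ) - 1‖ ≤ (1 + M ^ 2) * min 1 x := by
    obtain ⟨c1, c2⟩ := norm_cutoff_sub_one_le ψ y
    rcases le_or_gt ‖y‖ 1 with hy1 | hy1
    · rw [c2 hy1]
      positivity
    · refine c1.trans ?_
      have hy2 : N < M * ‖ξ‖ := by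
        rw [hy, norm_smul, norm_smul, Real.norm_eq_abs τ, norm_inv,
          Real.norm_of_nonneg (by positivity), lt_inv_mul_iff₀ (by positivity), mul_one] at hy1
        have : k * N < k * (M * ‖ξ‖) := hy1.trans_le (by
          calc |τ| * ‖ξ‖ ≤ M * k * ‖ξ‖ := by gcongr
            _ = k * (M * ‖ξ‖) := by ring)
        exact lt_of_mul_lt_mul_left this hk0.le
      have hy3 : 1 ≤ M ^ 2 * x := by
        calc (1 : ℝ) ≤ (M * ‖ξ‖) ^ 2 / N ^ 2 := by
              rw [one_le_div (by positivity)]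
              gcongr
          _ = 1 * (M ^ 2 * (‖ξ‖ ^ 2 / N ^ 2)) := by ring
          _ ≤ k * (M ^ 2 * (‖ξ‖ ^ 2 / N ^ 2)) := by gcongr
          _ = M ^ 2 * x := by
              rw [hxdef]
              ring
      rw [mul_min_of_nonneg _ _ (by positivity)]
      refine le_min ?_ ?_
      · nlinarith [sq_nonneg M]
      · linarith
  calc _ ≤ (2 + M) * min 1 x + (1 + M ^ 2) * min 1 x := h1.trans (add_le_add h2 h3)
    _ = _ := by ring

/-! ### Scaling of the norms -/

/-- The size of `scaledNorm` at the scales of `𝒢_n(t)`, where `s` is of size `N = t ^ {ρ/2}` and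
`μ = N |n|^{-1/2}`. The second term loses `(N / μ) ^ (δ - d/2)`, a power of `|n|`. -/
theorem scaledNorm_dilation_le {δ : ℝ} (h₁ : (d : ℝ) / 2 < δ) {s N k q τ : ℝ} (hN : 0 < N)
    (hk : 1 ≤ k) (hq : 0 < q) (hs : q * N ≤ s) (hτ : k ≤ |τ|) (φ : L2 d) :
    scaledNorm δ s (N * k ^ (-(1 / 2 : ℝ))) (dilation τ φ) ≤
      ENNReal.ofReal ((q ^ (-δ) + q ^ (-(d / 2 : ℝ))) *
        (N ^ (-δ) * k ^ (-δ + (δ - d / 2) / 2))) * (hSobNorm δ φ + weightedNorm δ φ) := by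
  have hk0 : 0 < k := by linarith
  have hτ0 : τ ≠ 0 := by
    rw [← abs_pos]
    linarith
  have hd0 : (0 : ℝ) ≤ d / 2 := by positivity
  have hδ : 0 < δ := by linarith
  have hqN : 0 < q * N := by positivity
  have hs0 : 0 < s := by linarith
  have p1 := Real.rpow_pos_of_pos hq (-δ)
  have p2 := Real.rpow_pos_of_pos hq (-(d / 2 : ℝ))
  have p3 := Real.rpow_pos_of_pos hN (-δ)
  have p4 := Real.rpow_pos_of_pos hk0 (-δ + (δ - d / 2) / 2)
  have hτk : |τ| ^ (-δ) ≤ k ^ (-δ) := Real.rpow_le_rpow_of_nonpos hk0 hτ (by linarith)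
  have g1 : s ^ (-δ) * |τ| ^ (-δ) ≤
      (q ^ (-δ) + q ^ (-(d / 2 : ℝ))) * (N ^ (-δ) * k ^ (-δ + (δ - d / 2) / 2)) := by
    calc s ^ (-δ) * |τ| ^ (-δ) ≤ (q * N) ^ (-δ) * k ^ (-δ + (δ - d / 2) / 2) := by
          refine mul_le_mul (Real.rpow_le_rpow_of_nonpos hqN hs (by linarith))
            (hτk.trans (Real.rpow_le_rpow_of_exponent_le hk (by linarith)))
            (by positivity) (by positivity)
      _ = q ^ (-δ) * (N ^ (-δ) * k ^ (-δ + (δ - d / 2) / 2)) := by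
          rw [Real.mul_rpow hq.le hN.le, mul_assoc]
      _ ≤ _ := by
          gcongr
          linarith
  have g2 : s ^ (-(d / 2 : ℝ)) * (N * k ^ (-(1 / 2 : ℝ))) ^ ((d / 2 : ℝ) - δ) * |τ| ^ (-δ) ≤
      (q ^ (-δ) + q ^ (-(d / 2 : ℝ))) * (N ^ (-δ) * k ^ (-δ + (δ - d / 2) / 2)) := by
    calc s ^ (-(d / 2 : ℝ)) * (N * k ^ (-(1 / 2 : ℝ))) ^ ((d / 2 : ℝ) - δ) * |τ| ^ (-δ)
        ≤ (q * N) ^ (-(d / 2 : ℝ)) * (N * k ^ (-(1 / 2 : ℝ))) ^ ((d / 2 : ℝ) - δ) *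
            k ^ (-δ) := by
          refine mul_le_mul (mul_le_mul_of_nonneg_right
            (Real.rpow_le_rpow_of_nonpos hqN hs (by linarith)) (by positivity)) hτk
            (by positivity) (by positivity)
      _ = q ^ (-(d / 2 : ℝ)) * ((N ^ (-(d / 2 : ℝ)) * N ^ ((d / 2 : ℝ) - δ)) *
            (k ^ (-(1 / 2 : ℝ) * ((d / 2 : ℝ) - δ)) * k ^ (-δ))) := by
          rw [Real.mul_rpow hq.le hN.le, Real.mul_rpow hN.le (by positivity),
            ← Real.rpow_mul hk0.le]
          ring
      _ = q ^ (-(d / 2 : ℝ)) * (N ^ (-δ) * k ^ (-δ + (δ - d / 2) / 2)) := by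
          rw [← Real.rpow_add hN, ← Real.rpow_add hk0]
          congr 3 <;> ring
      _ ≤ _ := by
          gcongr
          linarith
  rw [scaledNorm, hSobNorm_dilation δ hτ0, weightedNorm_dilation δ hτ0, ← mul_assoc, ← mul_assoc,
    ← ENNReal.ofReal_mul (by positivity), ← ENNReal.ofReal_mul (by positivity), mul_add, add_comm]
  gcongr

/-- For `δ > d/2` the function `min(1, |ξ|²) |ξ|^{-δ}` is square integrable at infinity, for `δ ≤ 2`
the weight `(1 + i a |x|²)⁻¹` is at most `(√|a| |x|)^{-δ}`, and for `δ < 1 + d/2` the function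
`|ξ|^{1-δ}` is square integrable near the origin. -/
theorem DeltaRange.bounds (hd1 : 1 ≤ d) {lam δ : ℝ} (h0 : 0 < lam) (h1 : lam < 1 / 2)
    (h : DeltaRange d lam δ) : (d : ℝ) / 2 < δ ∧ δ ≤ 2 ∧ δ < 1 + (d : ℝ) / 2 := by
  have hpos : 0 < 2 * (1 - 2 * lam) := by linarith
  rw [DeltaRange] at h
  split_ifs at h with hd
  · obtain ⟨ha, hb⟩ := h
    subst hd
    rw [div_lt_iff₀ hpos] at ha
    push_cast
    refine ⟨?_, by linarith, by linarith⟩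
    by_contra! hle
    nlinarith
  · obtain ⟨ha, hb⟩ := h
    have hb2 : δ < 2 := hb.trans_le (min_le_left _ _)
    have hd2 : (2 : ℝ) ≤ d := by exact_mod_cast (by omega : 2 ≤ d)
    refine ⟨lt_of_le_of_lt ?_ ha, hb2.le, by linarith⟩
    rw [div_le_div_iff₀ two_pos hpos]
    nlinarith

/-! ### Bounds for the operator -/

/-- The bounds for `𝒢_n(t)` under the size conditions on the coefficients, for `d/2 < δ ≤ 2` and
`δ < 1 + d/2`. -/
theorem exists_eLpNorm_opG_le (hd1 : 1 ≤ d) (hd : d < 4) {ζ₁ ζ₂ : ℝ → ℝ} {lam T₀ c M δ : ℝ}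
    (hT1 : 1 ≤ T₀) (hc : 0 < c) (hM : 0 < M)
    (hT : ∀ t, T₀ ≤ t → ∀ n : ℤ, n ≠ 0 → n ≠ 1 →
      |(n : ℝ)| ≤ |coeffC ζ₁ ζ₂ n t| ∧ |coeffC ζ₁ ζ₂ n t| ≤ M * |(n : ℝ)| ∧
      c * t ^ (1 - 2 * lam) ≤ |t * deriv (coeffA ζ₁ ζ₂ n) t| ∧
      |t * deriv (coeffA ζ₁ ζ₂ n) t| ≤ M * t ^ (1 - 2 * lam) ∧
      |coeffB ζ₁ ζ₂ n t| * t ^ (1 - 2 * lam) ≤ M * |(n : ℝ)|)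
    (b1 : (d : ℝ) / 2 < δ) (b2 : δ ≤ 2) (b3 : δ < 1 + (d : ℝ) / 2) (ψ : Cutoff d) :
    ∃ C : ℝ, 0 < C ∧ ∀ t, T₀ ≤ t → ∀ n : ℤ, n ≠ 0 → n ≠ 1 → ∀ φ : L2 d,
      eLpNorm (opG lam ζ₁ ζ₂ ψ n t φ) 2 volume ≤
        ENNReal.ofReal (C * t ^ (-(δ / 2) * (1 - 2 * lam)) *
          |(n : ℝ)| ^ (-δ + (δ - d / 2) / 2)) * (hSobNorm δ φ + weightedNorm δ φ) ∧
      ∀ r : ℝ≥0∞, 2 < r →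
        eLpNorm (expLap (-coeffB ζ₁ ζ₂ n t) (opG lam ζ₁ ζ₂ ψ n t φ)) r volume ≤
          ENNReal.ofReal (C * √M ^ ((d : ℝ) * (1 / 2 - (r⁻¹).toReal)) *
            t ^ ((d * (1 / 2 - (r⁻¹).toReal) - δ) / 2 * (1 - 2 * lam)) *
            |(n : ℝ)| ^ (-δ + (δ - d / 2) / 2)) * (hSobNorm δ φ + weightedNorm δ φ) := by
  have hqc : 0 < √c := Real.sqrt_pos.2 hc
  have hqM : 0 < √M := Real.sqrt_pos.2 hM
  -- `s = √|a|` satisfies `√c N ≤ s ≤ √M N`: so the frequencies `≤ 2 N` are `≤ (2 / √c) s`, and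
  -- `μ ≤ N ≤ s / √c`
  obtain ⟨C, hC, H⟩ := exists_eLpNorm_expLap_mulOp_regFun_le (d := d) hd1 hd b1 b2 b3
    (K := 3 + M + M ^ 2) (L := 2 / √c) (κ := 1 / √c) (by positivity) (by positivity)
    (by positivity)
  set Q := √c ^ (-δ) + √c ^ (-(d / 2 : ℝ)) with hQ
  have hQ0 : 0 < Q := by positivity
  refine ⟨C * Q, by positivity, fun t ht n hn0 hn1 φ => ?_⟩
  obtain ⟨h3, h4, h5, h6, h7⟩ := hT t ht n hn0 hn1
  have hk := (abs_intCast_sub_one_bounds hn0 hn1).1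
  have ht0 : 0 < t := by linarith
  have hCn : coeffC ζ₁ ζ₂ n t ≠ 0 := by
    rw [← abs_pos]
    linarith
  rw [opG_eq ψ hCn]
  set k := |(n : ℝ)| with hkdef
  set a := t * deriv (coeffA ζ₁ ζ₂ n) t with hadef
  set N := t ^ ((1 - 2 * lam) / 2) with hNdef
  set τ := coeffC ζ₁ ζ₂ n t with hτ
  set b := coeffB ζ₁ ζ₂ n t with hb
  have hk0 : 0 < k := by linarith
  have hN : 0 < N := Real.rpow_pos_of_pos ht0 _
  have hN2 : N ^ 2 = t ^ (1 - 2 * lam) := by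
    rw [hNdef, ← Real.rpow_natCast, ← Real.rpow_mul ht0.le]
    congr 1
    push_cast
    ring
  rw [← hN2] at h5 h6 h7
  have hs1 : √c * N ≤ √|a| := by
    rw [← Real.sqrt_sq hN.le, ← Real.sqrt_mul hc.le]
    exact Real.sqrt_le_sqrt h5
  have hs2 : √|a| ≤ √M * N := by
    rw [← Real.sqrt_sq hN.le, ← Real.sqrt_mul hM.le]
    exact Real.sqrt_le_sqrt h6
  have ha : a ≠ 0 := by
    rw [← abs_pos]
    exact lt_of_lt_of_le (by positivity) h5
  have hμ : N * k ^ (-(1 / 2 : ℝ)) ≤ 1 / √c * √|a| := by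
    calc N * k ^ (-(1 / 2 : ℝ)) ≤ N * 1 := by
          gcongr
          exact Real.rpow_le_one_of_one_le_of_nonpos hk (by norm_num)
      _ = 1 / √c * (√c * N) := by field_simp
      _ ≤ _ := by gcongr
  obtain ⟨e1, e2⟩ := H a (N * k ^ (-(1 / 2 : ℝ))) ha (by positivity) hμ
    (symG ψ b τ (k * N)) (bddSymbol_symG ψ b τ (k * N))
    (norm_symG_sub_one_le ψ hN hk hM h7 h4) (norm_symG_le ψ b τ (k * N))
    (fun ξ hξ => symG_eq_zero ψ b (by positivity) (by
      have h8 : 2 * N < ‖ξ‖ := by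
        refine lt_of_le_of_lt ?_ hξ
        calc 2 * N = 2 / √c * (√c * N) := by field_simp
          _ ≤ _ := by gcongr
      calc 2 * (k * N) = k * (2 * N) := by ring
        _ < k * ‖ξ‖ := by gcongr
        _ ≤ |τ| * ‖ξ‖ := by gcongr)) (dilation τ φ)
  have hS := scaledNorm_dilation_le (φ := φ) b1 hN hk hqc hs1 h3
  have hNp : ∀ x : ℝ, N ^ x = t ^ (x / 2 * (1 - 2 * lam)) := fun x => by
    rw [hNdef, ← Real.rpow_mul ht0.le]
    congr 1
    ring
  refine ⟨e1.trans ((mul_le_mul_right hS _).trans (le_of_eq ?_)), fun r hr => ?_⟩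
  · rw [← mul_assoc, ← ENNReal.ofReal_mul hC.le, hNp, neg_div]
    congr 2
    ring
  · have hν : 0 ≤ (d : ℝ) * (1 / 2 - (r⁻¹).toReal) := by
      have h2 : (r⁻¹).toReal ≤ ((2 : ℝ≥0∞)⁻¹).toReal :=
        ENNReal.toReal_mono (by norm_num) (ENNReal.inv_le_inv.2 hr.le)
      rw [ENNReal.toReal_inv 2, ENNReal.toReal_ofNat] at h2
      exact mul_nonneg (by positivity) (by linarith)
    set ν := (d : ℝ) * (1 / 2 - (r⁻¹).toReal) with hνdef
    have hsν : C * √|a| ^ ν ≤ C * √M ^ ν * N ^ ν := by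
      rw [mul_assoc, ← Real.mul_rpow hqM.le hN.le]
      gcongr
    refine (e2 (-b) r hr.le).trans ((mul_le_mul' (ENNReal.ofReal_le_ofReal hsν) hS).trans
      (le_of_eq ?_))
    rw [← mul_assoc, ← ENNReal.ofReal_mul (by positivity), ← hNp, sub_eq_add_neg _ δ,
      Real.rpow_add hN]
    congr 2
    ring

end TDHarmonic

end

theorem mainTheorem8 {d : ℕ} (hd1 : 1 ≤ d) (hd3 : d ≤ 3) (σ ζ₁ ζ₂ : ℝ → ℝ) (r₀ lam : ℝ)
    (hA : TDHarmonic.TimeDecay σ ζ₁ ζ₂ r₀ lam)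
    (hpos : ∀ t, r₀ < t → 0 ≤ ζ₁ t ∧ 0 ≤ ζ₂ t)
    (hlam0 : 0 < lam) (hlam : lam < TDHarmonic.lamMax d) :
    ∃ T₀ : ℝ, 1 ≤ T₀ ∧ r₀ < T₀ ∧
      (∀ t, T₀ ≤ t → ∀ n : ℤ, n ≠ 0 → n ≠ 1 →
        ζ₂ t ≠ 0 ∧ TDHarmonic.coeffC ζ₁ ζ₂ n t ≠ 0 ∧
          DifferentiableAt ℝ (TDHarmonic.coeffA ζ₁ ζ₂ n) t) ∧
      ∀ δ : ℝ, TDHarmonic.DeltaRange d lam δ → ∀ ψ : TDHarmonic.Cutoff d,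
        (∃ C : ℝ, 0 < C ∧ ∀ t, T₀ ≤ t → ∀ n : ℤ, n ≠ 0 → n ≠ 1 → ∀ φ : TDHarmonic.L2 d,
          eLpNorm (TDHarmonic.opG lam ζ₁ ζ₂ ψ n t φ) 2 volume ≤
            ENNReal.ofReal (C * t ^ (-(δ / 2) * (1 - 2 * lam)) *
                |(n : ℝ)| ^ (-δ + (δ - d / 2) / 2)) *
              (TDHarmonic.hSobNorm δ φ +
                ENNReal.ofReal |ψ.toFun 0| * TDHarmonic.weightedNorm δ φ)) ∧
        (∀ r : ℝ≥0∞, 2 < r →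
          ∃ C : ℝ, 0 < C ∧ ∀ t, T₀ ≤ t → ∀ n : ℤ, n ≠ 0 → n ≠ 1 → ∀ φ : TDHarmonic.L2 d,
            eLpNorm (TDHarmonic.expLap (-TDHarmonic.coeffB ζ₁ ζ₂ n t)
                (TDHarmonic.opG lam ζ₁ ζ₂ ψ n t φ)) r volume ≤
              ENNReal.ofReal (C * t ^ ((d * (1 / 2 - (r⁻¹).toReal) - δ) / 2 * (1 - 2 * lam)) *
                  |(n : ℝ)| ^ (-δ + (δ - d / 2) / 2)) *
                (TDHarmonic.hSobNorm δ φ +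
                  ENNReal.ofReal |ψ.toFun 0| * TDHarmonic.weightedNorm δ φ)) := by
  obtain ⟨T₀, c, M, hT1, hTr, hc, hM, hT⟩ := hA.exists_coeff_bounds hpos hlam0
  refine ⟨T₀, hT1, hTr, fun t ht n hn0 hn1 => ?_, fun δ hδ ψ => ?_⟩
  · obtain ⟨h1, h2, h3, -⟩ := hT t ht n hn0 hn1
    exact ⟨h1, abs_pos.1 (lt_of_lt_of_le (abs_pos.2 (Int.cast_ne_zero.2 hn0)) h3), h2⟩
  obtain ⟨b1, b2, b3⟩ := hδ.bounds hd1 hlam0 hA.lam_lt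
  have hψ : ENNReal.ofReal |ψ.toFun 0| = 1 := by
    rw [ψ.eq_one 0 (by simp), abs_one, ENNReal.ofReal_one]
  obtain ⟨C, hC, H⟩ := TDHarmonic.exists_eLpNorm_opG_le hd1 (by omega) hT1 hc hM
    (fun t ht n hn0 hn1 => (hT t ht n hn0 hn1).2.2) b1 b2 b3 ψ
  rw [hψ]
  refine ⟨⟨C, hC, fun t ht n hn0 hn1 φ => ?_⟩, fun r hr =>
    ⟨C * √M ^ ((d : ℝ) * (1 / 2 - (r⁻¹).toReal)), by positivity, fun t ht n hn0 hn1 φ => ?_⟩⟩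
  · rw [one_mul]
    exact (H t ht n hn0 hn1 φ).1
  · rw [one_mul]
    exact (H t ht n hn0 hn1 φ).2 r hr
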